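/- Let $A\in\mathbb{Q}^{n\times n}$ be expanding (all complex eigenvalues have modulus $>1$), put $B=A^{-1}$, and let $\mathbb{Z}^n[M]=\sum_{k\ge 0}M^k\mathbb{Z}^n$ for $M\in\{A,B\}$, $\mathbb{Z}^n(A)=\sum_{k\in\mathbb{Z}}A^k\mathbb{Z}^n$, $a=|\mathbb{Z}^n[A]/A\mathbb{Z}^n[A]|$ and $b=|\mathbb{Z}^n[B]/B\mathbb{Z}^n[B]|$. For $y\in\mathbb{Z}^n(A)$ let $\nu(y)$ be the integer $k$ with $y\in B^k\mathbb{Z}^n[B]\setminus B^{k+1}\mathbb{Z}^n[B]$, and $\nu(y)=\infty$ if there is no such $k$. Let $\mathbb{Z}^n((B))$ be the (Hausdorff) completion of $\mathbb{Z}^n(A)$ with respect to $\mathbf{d}_B(y,y')=b^{-\nu(y-y')}$, where $b^{-\infty}=0$, and let $\mathbb{Z}^n[[B]]$ be its closed unit ball around $0$. Let $\mathbb{K}_A=\mathbb{R}^n\times\mathbb{Z}^n((B))$ with the maximum of the Euclidean metric and $\mathbf{d}_B$, on which $A$ acts by multiplication in both factors; let $\varphi:\mathbb{Z}^n(A)\to\mathbb{K}_A$,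 $x\mapsto(x,x)$; and let $\mu$ be the Haar measure on $\mathbb{K}_A$ that is the product of Lebesgue measure and the Haar measure on $\mathbb{Z}^n((B))$ giving $\mathbb{Z}^n[[B]]$ measure $1$. Let $\mathcal{D}\subset\mathbb{Z}^n[A]$ with $|\mathcal{D}|=a$, so that $(A,\mathcal{D})$ is a digit system. For $k\ge 1$ let $\mathcal{D}_k=\{d_0+Ad_1+\dots+A^{k-1}d_{k-1} : d_0,\dots,d_{k-1}\in\mathcal{D}\}$, and let $\mathcal{D}_\infty=\bigcup_{k\ge 1}\mathcal{D}_k$. Then there is a unique nonempty compact set $\mathcal{F}\subset\mathbb{K}_A$ with $A\mathcal{F}=\bigcup_{d\in\mathcal{D}}(\mathcal{F}+\varphi(d))$, and $\mu(\mathcal{F})>0$ if and only if both of the following hold: 1. for every $k\ge 1$, the $a^k$ expansions $d_0+Ad_1+\dots+A^{k-1}d_{k-1}$ with digits in $\mathcal{D}$ are pairwise distinct; 2. $\varphi(\mathcal{D}_\infty)$ is uniformly discrete in $\mathbb{K}_A$, that is, there is $r>0$ such that every open ball of radius $r$ in $\mathbb{K}_A$ contains at most one point of $\varphi(\mathcal{D}_\infty)$.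 -/

import Mathlib

open MeasureTheory

noncomputable section

namespace RationalTile

variable {n : ℕ}

/-- A rational matrix is expanding if all its complex eigenvalues have modulus greater than `1`. -/
def IsExpanding (A : Matrix (Fin n) (Fin n) ℚ) : Prop :=
  ∀ z ∈ spectrum ℂ (A.map (algebraMap ℚ ℂ)), 1 < ‖z‖

/-- Multiplication by a matrix, as an additive endomorphism of `ℚⁿ`. -/
def act (M : Matrix (Fin n) (Fin n) ℚ) : (Fin n → ℚ) →+ (Fin n → ℚ) :=
  M.mulVecLin.toAddMonoidHom

/-- The lattice `ℤⁿ` inside `ℚⁿ`. -/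
def intLattice (n : ℕ) : AddSubgroup (Fin n → ℚ) where
  carrier := {v | ∀ i, ∃ m : ℤ, v i = m}
  zero_mem' := fun _ => ⟨0, by simp⟩
  add_mem' := fun {v w} hv hw i => by
    obtain ⟨p, hp⟩ := hv i
    obtain ⟨q, hq⟩ := hw i
    exact ⟨p + q, by simp [hp, hq]⟩
  neg_mem' := fun {v} hv i => by
    obtain ⟨p, hp⟩ := hv i
    exact ⟨-p, by simp [hp]⟩

/-- `ℤⁿ[M]`, the sum of the groups `M ^ k ℤⁿ` over all `k ≥ 0`. -/
def polyLattice (M : Matrix (Fin n) (Fin n) ℚ) : AddSubgroup (Fin n → ℚ) :=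
  ⨆ k : ℕ, (intLattice n).map (act (M ^ k))

/-- `ℤⁿ(M)`, the sum of the groups `M ^ k ℤⁿ` over all integers `k` (for invertible `M`). -/
def laurentLattice (M : Matrix (Fin n) (Fin n) ℚ) : AddSubgroup (Fin n → ℚ) :=
  ⨆ k : ℤ, (intLattice n).map (act (M ^ k))

/-- `M ^ k ℤⁿ[M]` for an integer `k` (and invertible `M`). -/
def filt (M : Matrix (Fin n) (Fin n) ℚ) (k : ℤ) : AddSubgroup (Fin n → ℚ) :=
  (polyLattice M).map (act (M ^ k))

theorem act_mul (M N : Matrix (Fin n) (Fin n) ℚ) : act (M * N) = (act M).comp (act N) := by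
  refine DFunLike.ext _ _ fun v => ?_
  simp [act]

theorem act_one : act (1 : Matrix (Fin n) (Fin n) ℚ) = AddMonoidHom.id _ := by
  refine DFunLike.ext _ _ fun v => ?_
  simp [act]

theorem act_map_polyLattice_le (M : Matrix (Fin n) (Fin n) ℚ) :
    (polyLattice M).map (act M) ≤ polyLattice M := by
  unfold polyLattice
  rw [AddSubgroup.map_iSup]
  refine iSup_le fun k => ?_
  rw [AddSubgroup.map_map, ← act_mul, ← pow_succ']
  exact le_iSup (fun k : ℕ => (intLattice n).map (act (M ^ k))) (k + 1)

theorem act_map_laurentLattice_le {M : Matrix (Fin n) (Fin n) ℚ} (hM : IsUnit M.det) :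
    (laurentLattice M).map (act M) ≤ laurentLattice M := by
  unfold laurentLattice
  rw [AddSubgroup.map_iSup]
  refine iSup_le fun k => ?_
  rw [AddSubgroup.map_map, ← act_mul, ← Matrix.zpow_one_add hM]
  exact le_iSup (fun k : ℤ => (intLattice n).map (act (M ^ k))) (1 + k)

theorem polyLattice_le_laurentLattice (M : Matrix (Fin n) (Fin n) ℚ) :
    polyLattice M ≤ laurentLattice M := by
  refine iSup_le fun k => ?_
  have h := le_iSup (fun k : ℤ => (intLattice n).map (act (M ^ k))) (k : ℤ)
  rwa [zpow_natCast] at h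

theorem IsExpanding.isUnit_det {A : Matrix (Fin n) (Fin n) ℚ} (hA : IsExpanding A) :
    IsUnit A.det := by
  rw [isUnit_iff_ne_zero]
  intro h
  have h0 : (0 : ℂ) ∈ spectrum ℂ (A.map (algebraMap ℚ ℂ)) := by
    rw [spectrum.zero_mem_iff, Matrix.isUnit_iff_isUnit_det]
    have : (A.map (algebraMap ℚ ℂ)).det = algebraMap ℚ ℂ A.det := by
      rw [RingHom.map_det]; rfl
    simp [this, h]
  have := hA 0 h0
  simp at this
  linarith

/-- Multiplication by `M` on `ℤⁿ[M]`. -/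
def mulPoly (M : Matrix (Fin n) (Fin n) ℚ) : polyLattice M →+ polyLattice M :=
  ((act M).comp (polyLattice M).subtype).codRestrict (polyLattice M)
    fun x => act_map_polyLattice_le M ⟨x, x.2, rfl⟩

/-- The order `|ℤⁿ[M] / M ℤⁿ[M]|`. -/
def residueCard (M : Matrix (Fin n) (Fin n) ℚ) : ℕ :=
  Nat.card (polyLattice M ⧸ (mulPoly M).range)

/-! ### The `B`-adic valuation on `ℤⁿ(A) = ℤⁿ(B)`, where `B = A⁻¹` -/

/-- `ℤⁿ(A)` (which equals `ℤⁿ(B)`), as a type of its own, without the topology of `ℚⁿ`. -/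
def Laurent {A : Matrix (Fin n) (Fin n) ℚ} (_hA : IsExpanding A) : Type :=
  laurentLattice A

instance {A : Matrix (Fin n) (Fin n) ℚ} (hA : IsExpanding A) : AddCommGroup (Laurent hA) :=
  inferInstanceAs (AddCommGroup (laurentLattice A))

/-- The underlying vector of an element of `ℤⁿ(A)`. -/
def Laurent.vec {A : Matrix (Fin n) (Fin n) ℚ} (hA : IsExpanding A) :
    Laurent hA →+ (Fin n → ℚ) :=
  (laurentLattice A).subtype

open Classical in
/-- The `B`-adic valuation: the `k` with `y ∈ B ^ k ℤⁿ[B] \ B ^ (k + 1) ℤⁿ[B]` (there is at most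
one), and `∞` if there is none, that is, if `y` lies in `B ^ k ℤⁿ[B]` for every `k`. -/
def nu {A : Matrix (Fin n) (Fin n) ℚ} (hA : IsExpanding A) (y : Laurent hA) : WithTop ℤ :=
  if h : ∃ k : ℤ, Laurent.vec hA y ∈ filt A⁻¹ k ∧ Laurent.vec hA y ∉ filt A⁻¹ (k + 1)
  then (h.choose : WithTop ℤ) else ⊤

/-- `b ^ (-v)`, with the convention `b ^ (-∞) = 0`. -/
def negPow (b : ℕ) : WithTop ℤ → ℝ
  | ⊤ => 0
  | (k : ℤ) => (b : ℝ) ^ (-k)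

theorem filt_antitone {M : Matrix (Fin n) (Fin n) ℚ} (hM : IsUnit M.det) :
    Antitone (filt M) := by
  refine antitone_int_of_succ_le fun k => ?_
  unfold filt
  rw [Matrix.zpow_add_one hM, act_mul, ← AddSubgroup.map_map]
  exact AddSubgroup.map_mono (act_map_polyLattice_le M)

theorem map_filt {M : Matrix (Fin n) (Fin n) ℚ} (hM : IsUnit M.det) (j k : ℤ) :
    (filt M k).map (act (M ^ j)) = filt M (j + k) := by
  unfold filt
  rw [AddSubgroup.map_map, ← act_mul, ← Matrix.zpow_add hM]

theorem filt_zero (M : Matrix (Fin n) (Fin n) ℚ) : filt M 0 = polyLattice M := by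
  simp [filt, act_one]

theorem act_zpow_injective {M : Matrix (Fin n) (Fin n) ℚ} (hM : IsUnit M.det) (j : ℤ) :
    Function.Injective (act (M ^ j)) := by
  have h : (act (M ^ (-j))).comp (act (M ^ j)) = AddMonoidHom.id _ := by
    rw [← act_mul, ← Matrix.zpow_add hM, neg_add_cancel, zpow_zero, act_one]
  intro x y hxy
  have hx := DFunLike.congr_fun h x
  have hy := DFunLike.congr_fun h y
  simp only [AddMonoidHom.comp_apply, AddMonoidHom.id_apply] at hx hy
  rw [← hx, ← hy, hxy]

theorem exists_mem_filt {A : Matrix (Fin n) (Fin n) ℚ} (hA : IsExpanding A) (y : Laurent hA) :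
    ∃ k : ℤ, Laurent.vec hA y ∈ filt A⁻¹ k := by
  have hB : IsUnit (A⁻¹).det := by simpa using hA.isUnit_det
  have hle : laurentLattice A ≤ ⨆ k : ℤ, filt A⁻¹ k := by
    refine iSup_le fun k => le_trans ?_ (le_iSup (filt A⁻¹) (-k))
    unfold filt
    rw [Matrix.inv_zpow' hA.isUnit_det, neg_neg]
    refine AddSubgroup.map_mono ?_
    have h := le_iSup (fun k : ℕ => (intLattice n).map (act (A⁻¹ ^ k))) 0
    have e : act (A⁻¹ ^ 0) = AddMonoidHom.id _ := by rw [pow_zero, act_one]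
    rwa [e, AddSubgroup.map_id] at h
  have hy : Laurent.vec hA y ∈ ⨆ k : ℤ, filt A⁻¹ k := hle (Subtype.prop (p := (· ∈ laurentLattice A)) y)
  rwa [AddSubgroup.mem_iSup_of_directed (filt_antitone hB).directed_le] at hy

theorem exists_int_matrix (A : Matrix (Fin n) (Fin n) ℚ) :
    ∃ m : ℕ, m ≠ 0 ∧ ∀ v ∈ intLattice n, m • act A v ∈ intLattice n := by
  refine ⟨∏ i, ∏ j, (A i j).den, ?_, ?_⟩
  · exact Finset.prod_ne_zero_iff.2 fun i _ => Finset.prod_ne_zero_iff.2 fun j _ => (A i j).den_nz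
  · intro v hv i
    choose z hz using hv
    have key : ∀ j, ∃ q : ℤ, ((∏ i, ∏ j, (A i j).den : ℕ) : ℚ) * A i j = q := by
      intro j
      have hd : (A i j).den ∣ ∏ i, ∏ j, (A i j).den :=
        (Finset.dvd_prod_of_mem (fun j => (A i j).den) (Finset.mem_univ j)).trans
          (Finset.dvd_prod_of_mem (fun i => ∏ j, (A i j).den) (Finset.mem_univ i))
      obtain ⟨c, hc⟩ := hd
      refine ⟨c * (A i j).num, ?_⟩
      rw [hc]
      push_cast
      have := Rat.den_mul_eq_num (A i j)
      rw [mul_comm ((A i j).den : ℚ), mul_assoc, this]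
    choose q hq using key
    refine ⟨∑ j, q j * z j, ?_⟩
    simp only [act, Pi.smul_apply, nsmul_eq_mul, LinearMap.toAddMonoidHom_coe,
      Matrix.mulVecLin_apply, Matrix.mulVec, dotProduct, Finset.mul_sum]
    push_cast
    refine Finset.sum_congr rfl fun j _ => ?_
    rw [← mul_assoc, ← hz j, ← hq j]
    push_cast
    ring

theorem intLattice_le_polyLattice (M : Matrix (Fin n) (Fin n) ℚ) :
    intLattice n ≤ polyLattice M := by
  have h := le_iSup (fun k : ℕ => (intLattice n).map (act (M ^ k))) 0
  have e : act (M ^ 0) = AddMonoidHom.id _ := by rw [pow_zero, act_one]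
  rwa [e, AddSubgroup.map_id] at h

theorem polyLattice_le_sup (M : Matrix (Fin n) (Fin n) ℚ) :
    polyLattice M ≤ intLattice n ⊔ (polyLattice M).map (act M) := by
  refine iSup_le fun k => ?_
  cases k with
  | zero =>
    have e : act (M ^ 0) = AddMonoidHom.id _ := by rw [pow_zero, act_one]
    rw [e, AddSubgroup.map_id]
    exact le_sup_left
  | succ k =>
    refine le_trans ?_ le_sup_right
    rw [pow_succ', act_mul, ← AddSubgroup.map_map]
    exact AddSubgroup.map_mono (le_iSup (fun k : ℕ => (intLattice n).map (act (M ^ k))) k)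

theorem finite_residue {M : Matrix (Fin n) (Fin n) ℚ} (hM : IsUnit M.det) :
    Finite (polyLattice M ⧸ (mulPoly M).range) := by
  let c : (Fin n → ℤ) →+ (Fin n → ℚ) :=
    { toFun := fun z i => z i
      map_zero' := by ext; simp
      map_add' := fun x y => by ext; simp }
  have hc : ∀ z, c z ∈ intLattice n := fun z i => ⟨z i, rfl⟩
  let f : (Fin n → ℤ) →+ polyLattice M ⧸ (mulPoly M).range :=
    (QuotientAddGroup.mk' _).comp
      (c.codRestrict (polyLattice M) fun z => intLattice_le_polyLattice M (hc z))
  have hf : Function.Surjective f := by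
    intro q
    obtain ⟨⟨x, hx⟩, rfl⟩ := QuotientAddGroup.mk_surjective q
    obtain ⟨u, hu, w, ⟨p, hp, rfl⟩, hs⟩ := AddSubgroup.mem_sup.1 (polyLattice_le_sup M hx)
    choose z hz using hu
    refine ⟨z, ?_⟩
    refine QuotientAddGroup.eq.2 ⟨⟨p, hp⟩, ?_⟩
    apply Subtype.ext
    change act M p = -(c z) + x
    have : c z = u := funext fun i => (hz i).symm
    rw [this, ← hs]
    abel
  have hfg : AddGroup.FG (polyLattice M ⧸ (mulPoly M).range) := AddGroup.fg_of_surjective hf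
  obtain ⟨m, hm, hmA⟩ := exists_int_matrix M⁻¹
  refine AddCommGroup.finite_of_fg_isAddTorsion _ fun q => ?_
  obtain ⟨z, rfl⟩ := hf q
  refine isOfFinAddOrder_iff_nsmul_eq_zero.2 ⟨m, Nat.pos_of_ne_zero hm, ?_⟩
  rw [← map_nsmul]
  refine (QuotientAddGroup.eq_zero_iff _).2
    ⟨⟨_, intLattice_le_polyLattice M (hmA _ (hc z))⟩, Subtype.ext ?_⟩
  change act M (m • act M⁻¹ (c z)) = c (m • z)
  rw [map_nsmul, map_nsmul]
  have e : (act M).comp (act M⁻¹) = AddMonoidHom.id _ := by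
    rw [← act_mul, Matrix.mul_nonsing_inv _ hM, act_one]
  exact congrArg (m • ·) (DFunLike.congr_fun e (c z))

theorem residueCard_pos {M : Matrix (Fin n) (Fin n) ℚ} (hM : IsUnit M.det) :
    0 < residueCard M := by
  have := finite_residue hM
  exact Nat.card_pos

section Valuation

variable {A : Matrix (Fin n) (Fin n) ℚ} (hA : IsExpanding A)

theorem isUnit_det_inv {A : Matrix (Fin n) (Fin n) ℚ} (hA : IsExpanding A) :
    IsUnit (A⁻¹).det := by simpa using hA.isUnit_det

theorem nu_eq {y : Laurent hA} {k : ℤ} (h : Laurent.vec hA y ∈ filt A⁻¹ k)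
    (h' : Laurent.vec hA y ∉ filt A⁻¹ (k + 1)) : nu hA y = k := by
  have hex : ∃ k : ℤ, Laurent.vec hA y ∈ filt A⁻¹ k ∧ Laurent.vec hA y ∉ filt A⁻¹ (k + 1) :=
    ⟨k, h, h'⟩
  have hs := hex.choose_spec
  have hv : nu hA y = (hex.choose : WithTop ℤ) := by
    unfold nu
    rw [dif_pos hex]
  rw [hv]
  have hanti := filt_antitone (isUnit_det_inv hA)
  refine congrArg _ (le_antisymm ?_ ?_)
  · by_contra hlt
    exact h' (hanti (by lia) hs.1)
  · by_contra hlt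
    exact hs.2 (hanti (by lia) h)

theorem nu_eq_top {y : Laurent hA} (h : ∀ k, Laurent.vec hA y ∈ filt A⁻¹ k) :
    nu hA y = ⊤ := by
  unfold nu
  rw [dif_neg]
  rintro ⟨k, -, hk⟩
  exact hk (h _)

theorem nu_cases (y : Laurent hA) :
    (∀ k, Laurent.vec hA y ∈ filt A⁻¹ k) ∨
      ∃ k : ℤ, Laurent.vec hA y ∈ filt A⁻¹ k ∧ Laurent.vec hA y ∉ filt A⁻¹ (k + 1) := by
  by_cases h : ∃ k : ℤ, Laurent.vec hA y ∈ filt A⁻¹ k ∧ Laurent.vec hA y ∉ filt A⁻¹ (k + 1)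
  · exact Or.inr h
  · left
    push Not at h
    obtain ⟨k₀, hk₀⟩ := exists_mem_filt hA y
    intro k
    rcases le_total k k₀ with hk | hk
    · exact filt_antitone (isUnit_det_inv hA) hk hk₀
    · exact Int.leInduction hk₀ (fun j _ hj => h j hj) k hk

/-- The absolute value `b ^ (-ν y)` on `ℤⁿ(A)`, where `b = |ℤⁿ[B] / B ℤⁿ[B]|`. -/
def badicAbs (y : Laurent hA) : ℝ := negPow (residueCard A⁻¹) (nu hA y)

theorem one_le_b {A : Matrix (Fin n) (Fin n) ℚ} (hA : IsExpanding A) :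
    (1 : ℝ) ≤ residueCard A⁻¹ := by
  exact_mod_cast residueCard_pos (isUnit_det_inv hA)

theorem badicAbs_le {y : Laurent hA} {k : ℤ} (h : Laurent.vec hA y ∈ filt A⁻¹ k) :
    badicAbs hA y ≤ (residueCard A⁻¹ : ℝ) ^ (-k) := by
  rcases nu_cases hA y with hy | ⟨j, hj, hj'⟩
  · rw [badicAbs, nu_eq_top hA hy]
    change (0 : ℝ) ≤ _
    positivity
  · rw [badicAbs, nu_eq hA hj hj']
    change (residueCard A⁻¹ : ℝ) ^ (-j) ≤ _
    refine zpow_le_zpow_right₀ (one_le_b hA) ?_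
    by_contra hlt
    exact hj' (filt_antitone (isUnit_det_inv hA) (by lia) h)

theorem le_badicAbs {y : Laurent hA} {k : ℤ} (h : Laurent.vec hA y ∉ filt A⁻¹ (k + 1)) :
    (residueCard A⁻¹ : ℝ) ^ (-k) ≤ badicAbs hA y := by
  rcases nu_cases hA y with hy | ⟨j, hj, hj'⟩
  · exact absurd (hy _) h
  · rw [badicAbs, nu_eq hA hj hj']
    change _ ≤ (residueCard A⁻¹ : ℝ) ^ (-j)
    refine zpow_le_zpow_right₀ (one_le_b hA) ?_
    by_contra hlt
    exact h (filt_antitone (isUnit_det_inv hA) (by lia) hj)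

theorem badicAbs_nonneg (y : Laurent hA) : 0 ≤ badicAbs hA y := by
  rcases nu_cases hA y with hy | ⟨j, hj, hj'⟩
  · rw [badicAbs, nu_eq_top hA hy]
    exact le_rfl
  · rw [badicAbs, nu_eq hA hj hj']
    change (0 : ℝ) ≤ (residueCard A⁻¹ : ℝ) ^ (-j)
    positivity

theorem badicAbs_add_le_max (x y : Laurent hA) :
    badicAbs hA (x + y) ≤ max (badicAbs hA x) (badicAbs hA y) := by
  rcases nu_cases hA (x + y) with h | ⟨k, hk, hk'⟩
  · have : badicAbs hA (x + y) = 0 := by rw [badicAbs, nu_eq_top hA h]; rfl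
    rw [this]
    exact le_max_of_le_left (badicAbs_nonneg hA x)
  · refine (badicAbs_le hA hk).trans ?_
    rw [map_add] at hk'
    by_cases hx : Laurent.vec hA x ∈ filt A⁻¹ (k + 1)
    · by_cases hy : Laurent.vec hA y ∈ filt A⁻¹ (k + 1)
      · exact absurd (add_mem hx hy) hk'
      · exact le_max_of_le_right (le_badicAbs hA hy)
    · exact le_max_of_le_left (le_badicAbs hA hx)

theorem nu_neg (y : Laurent hA) : nu hA (-y) = nu hA y := by
  have e : ∀ k, (Laurent.vec hA (-y) ∈ filt A⁻¹ k ↔ Laurent.vec hA y ∈ filt A⁻¹ k) := fun k => by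
    rw [map_neg, neg_mem_iff]
  rcases nu_cases hA y with h | ⟨k, hk, hk'⟩
  · rw [nu_eq_top hA h, nu_eq_top hA fun k => (e k).2 (h k)]
  · rw [nu_eq hA hk hk', nu_eq hA ((e _).2 hk) (mt (e _).1 hk')]

theorem badicAbs_zero : badicAbs hA 0 = 0 := by
  rw [badicAbs, nu_eq_top hA (fun k => by rw [map_zero]; exact zero_mem _)]
  rfl

/-- The metric `d_B(y, y') = b ^ (-ν (y - y'))` on `ℤⁿ(A)`. -/
instance : SeminormedAddCommGroup (Laurent hA) :=
  AddGroupSeminorm.toSeminormedAddCommGroup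
    { toFun := badicAbs hA
      map_zero' := badicAbs_zero hA
      add_le' := fun x y => (badicAbs_add_le_max hA x y).trans
        (max_le_add_of_nonneg (badicAbs_nonneg hA x) (badicAbs_nonneg hA y))
      neg' := fun y => by rw [badicAbs, badicAbs, nu_neg] }

theorem norm_eq_badicAbs (y : Laurent hA) : ‖y‖ = badicAbs hA y := rfl

theorem dist_eq_badicAbs (y y' : Laurent hA) : dist y y' = badicAbs hA (y - y') := by
  rw [dist_eq_norm, norm_eq_badicAbs]

/-- The space `ℤⁿ((B))` of `B`-adic series: the completion of `ℤⁿ(A)` for `d_B`. Points at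
distance `0` are identified in this completion. -/
abbrev BadicSeries : Type := UniformSpace.Completion (Laurent hA)

instance : MeasurableSpace (BadicSeries hA) := borel _

instance : BorelSpace (BadicSeries hA) := ⟨rfl⟩

/-- Multiplication by `A` on `ℤⁿ(A)`. -/
def mulLaurent : Laurent hA →+ Laurent hA :=
  ((act A).comp (laurentLattice A).subtype).codRestrict (laurentLattice A)
    fun x => act_map_laurentLattice_le hA.isUnit_det ⟨x, x.2, rfl⟩

theorem vec_mulLaurent_mem {y : Laurent hA} {k : ℤ} (h : Laurent.vec hA y ∈ filt A⁻¹ k) :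
    Laurent.vec hA (mulLaurent hA y) ∈ filt A⁻¹ (k - 1) := by
  have e : (A⁻¹ ^ (-1 : ℤ)) = A := by
    rw [Matrix.inv_zpow' hA.isUnit_det, neg_neg, zpow_one]
  have := map_filt (isUnit_det_inv hA) (-1) k
  rw [e, neg_add_eq_sub] at this
  rw [← this]
  exact ⟨_, h, rfl⟩

theorem norm_mulLaurent_le (y : Laurent hA) :
    ‖mulLaurent hA y‖ ≤ residueCard A⁻¹ * ‖y‖ := by
  have hb : (0 : ℝ) < residueCard A⁻¹ := lt_of_lt_of_le one_pos (one_le_b hA)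
  rw [norm_eq_badicAbs, norm_eq_badicAbs]
  rcases nu_cases hA y with hy | ⟨j, hj, hj'⟩
  · have : badicAbs hA (mulLaurent hA y) = 0 := by
      rw [badicAbs, nu_eq_top hA]
      · rfl
      · intro k
        simpa using vec_mulLaurent_mem hA (hy (k + 1))
    rw [this]
    exact mul_nonneg hb.le (badicAbs_nonneg hA y)
  · refine (badicAbs_le hA (vec_mulLaurent_mem hA hj)).trans ?_
    have h2 := le_badicAbs hA hj'
    calc (residueCard A⁻¹ : ℝ) ^ (-(j - 1)) = residueCard A⁻¹ * (residueCard A⁻¹ : ℝ) ^ (-j) := by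
          rw [← zpow_one_add₀ hb.ne']; congr 1; ring
      _ ≤ _ := mul_le_mul_of_nonneg_left h2 hb.le

theorem continuous_mulLaurent : Continuous (mulLaurent hA) :=
  AddMonoidHomClass.continuous_of_bound _ _ (norm_mulLaurent_le hA)

/-- Multiplication by `A` on `ℤⁿ((B))`, the continuous extension of the one on `ℤⁿ(A)`. -/
def mulBadic : BadicSeries hA →+ BadicSeries hA :=
  (mulLaurent hA).completion (continuous_mulLaurent hA)

/-! ### Compactness of `ℤⁿ[[B]]`, and the `B`-adic measure -/

theorem relIndex_succ {A : Matrix (Fin n) (Fin n) ℚ} (hA : IsExpanding A) (k : ℤ) :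
    (filt A⁻¹ (k + 1)).relIndex (filt A⁻¹ k) = residueCard A⁻¹ := by
  have hB := isUnit_det_inv hA
  have h1 := map_filt hB k 1
  have h0 := map_filt hB k 0
  rw [add_zero] at h0
  rw [← h1, ← h0, AddSubgroup.relIndex_map_map_of_injective _ _ (act_zpow_injective hB k),
    filt_zero]
  unfold residueCard
  rw [← AddSubgroup.index_eq_card, AddSubgroup.relIndex]
  congr 1
  ext x
  rw [AddSubgroup.mem_addSubgroupOf, AddMonoidHom.mem_range]
  unfold filt
  rw [zpow_one]
  constructor
  · rintro ⟨p, hp, hpx⟩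
    exact ⟨⟨p, hp⟩, Subtype.ext hpx⟩
  · rintro ⟨p, rfl⟩
    exact ⟨p.1, p.2, rfl⟩

theorem filt_le_succ {A : Matrix (Fin n) (Fin n) ℚ} (hA : IsExpanding A)
    (hb : residueCard A⁻¹ = 1) (k : ℤ) : filt A⁻¹ k ≤ filt A⁻¹ (k + 1) :=
  AddSubgroup.relIndex_eq_one.1 ((relIndex_succ hA k).trans hb)

theorem relIndex_nat {A : Matrix (Fin n) (Fin n) ℚ} (hA : IsExpanding A) (N : ℕ) :
    (filt A⁻¹ N).relIndex (filt A⁻¹ 0) ≠ 0 := by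
  induction N with
  | zero => simp
  | succ N ih =>
    have hanti := filt_antitone (isUnit_det_inv hA)
    rw [← AddSubgroup.relIndex_mul_relIndex (filt A⁻¹ ((N + 1 : ℕ) : ℤ)) (filt A⁻¹ N) (filt A⁻¹ 0)
      (hanti (by lia)) (hanti (by lia))]
    refine mul_ne_zero ?_ ih
    rw [Nat.cast_succ, relIndex_succ hA]
    exact (residueCard_pos (isUnit_det_inv hA)).ne'

theorem mem_filt_zero_of_norm_lt {y : Laurent hA} (hy : ‖y‖ < 2) :
    Laurent.vec hA y ∈ filt A⁻¹ 0 := by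
  by_contra h
  have h1 : (residueCard A⁻¹ : ℝ) ^ (-(-1 : ℤ)) ≤ ‖y‖ := le_badicAbs hA (k := -1) (by simpa using h)
  rw [neg_neg, zpow_one] at h1
  have h2 : residueCard A⁻¹ < 2 := by exact_mod_cast h1.trans_lt hy
  have hb : residueCard A⁻¹ = 1 := by
    have := residueCard_pos (isUnit_det_inv hA)
    lia
  rcases nu_cases hA y with hy' | ⟨k, hk, hk'⟩
  · exact h (hy' 0)
  · exact hk' (filt_le_succ hA hb k hk)

theorem exists_norm_lt_of_mem {ε : ℝ} (hε : 0 < ε) :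
    ∃ N : ℕ, ∀ y : Laurent hA, Laurent.vec hA y ∈ filt A⁻¹ N → ‖y‖ < ε := by
  by_cases hb : residueCard A⁻¹ = 1
  · refine ⟨0, fun y _ => ?_⟩
    rcases nu_cases hA y with hy' | ⟨k, hk, hk'⟩
    · rw [norm_eq_badicAbs, badicAbs, nu_eq_top hA hy']
      exact hε
    · exact absurd (filt_le_succ hA hb k hk) hk'
  · have h1 : (1 : ℝ) < residueCard A⁻¹ := by
      have := residueCard_pos (isUnit_det_inv hA)
      exact_mod_cast (by lia : 1 < residueCard A⁻¹)
    obtain ⟨N, hN⟩ := exists_pow_lt_of_lt_one hε (inv_lt_one_of_one_lt₀ h1)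
    refine ⟨N, fun y hy => (badicAbs_le hA hy).trans_lt ?_⟩
    rwa [zpow_neg, zpow_natCast, ← inv_pow]

theorem totallyBounded_ball : TotallyBounded (Metric.ball (0 : Laurent hA) 2) := by
  rw [Metric.totallyBounded_iff]
  intro ε hε
  obtain ⟨N, hN⟩ := exists_norm_lt_of_mem hA hε
  let G : ℤ → AddSubgroup (Laurent hA) := fun k => (filt A⁻¹ k).comap (Laurent.vec hA)
  have hfin : (G N).relIndex (G 0) ≠ 0 := by
    change ((filt A⁻¹ N).comap (Laurent.vec hA)).relIndex (G 0) ≠ 0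
    rw [AddSubgroup.relIndex_comap]
    exact mt (AddSubgroup.relIndex_eq_zero_of_le_right (AddSubgroup.map_comap_le _ _))
      (relIndex_nat hA N)
  have : ((G N).addSubgroupOf (G 0)).FiniteIndex := ⟨hfin⟩
  have : Finite (G 0 ⧸ (G N).addSubgroupOf (G 0)) :=
    AddSubgroup.finite_quotient_of_finiteIndex
  refine ⟨Set.range fun q : G 0 ⧸ (G N).addSubgroupOf (G 0) => (q.out : Laurent hA),
    Set.finite_range _, fun y hy => ?_⟩
  have hy0 : y ∈ G 0 := mem_filt_zero_of_norm_lt hA (by simpa using hy)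
  rw [Set.biUnion_range, Set.mem_iUnion]
  refine ⟨QuotientAddGroup.mk ⟨y, hy0⟩, ?_⟩
  rw [Metric.mem_ball, dist_eq_norm, ← neg_add_eq_sub]
  refine hN _ ?_
  have h := QuotientAddGroup.eq.1 (Quotient.out_eq
    (QuotientAddGroup.mk ⟨y, hy0⟩ : G 0 ⧸ (G N).addSubgroupOf (G 0)))
  exact h

theorem isCompact_unitBall : IsCompact (Metric.closedBall (0 : BadicSeries hA) 1) := by
  refine TotallyBounded.isCompact_of_isClosed ?_ Metric.isClosed_closedBall
  refine (((totallyBounded_ball hA).image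
    (UniformSpace.Completion.uniformContinuous_coe (Laurent hA))).closure).subset ?_
  intro y hy
  rw [mem_closedBall_zero_iff] at hy
  refine Metric.mem_closure_iff.2 fun ε hε => ?_
  obtain ⟨z, hz⟩ := (UniformSpace.Completion.denseRange_coe (α := Laurent hA)).exists_dist_lt y
    (lt_min hε one_pos)
  refine ⟨z, ⟨z, ?_, rfl⟩, hz.trans_le (min_le_left _ _)⟩
  rw [mem_ball_zero_iff, ← UniformSpace.Completion.norm_coe]
  have h1 := hz.trans_le (min_le_right _ _)
  rw [dist_eq_norm, norm_sub_rev] at h1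
  have h2 := norm_add_le ((z : BadicSeries hA) - y) y
  rw [sub_add_cancel] at h2
  linarith

/-- `ℤⁿ[[B]]`, the set of all `y` with `ν y ≥ 0`, that is, with `d_B(y, 0) ≤ 1`. -/
def badicIntegers : TopologicalSpace.PositiveCompacts (BadicSeries hA) where
  carrier := Metric.closedBall 0 1
  isCompact' := isCompact_unitBall hA
  interior_nonempty' :=
    ⟨0, Metric.ball_subset_interior_closedBall (Metric.mem_ball_self one_pos)⟩

/-- The `B`-adic measure: the Haar measure on `ℤⁿ((B))` that gives `ℤⁿ[[B]]` measure `1`. -/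
def badicMeasure : Measure (BadicSeries hA) :=
  Measure.addHaarMeasure (badicIntegers hA)

/-- The representation space `ℝⁿ × ℤⁿ((B))`, with the maximum of the Euclidean and the `B`-adic
metric. -/
abbrev RepSpace : Type := EuclideanSpace ℝ (Fin n) × BadicSeries hA

/-- The Haar measure on the representation space: Lebesgue measure times `B`-adic measure. -/
def repMeasure : Measure (RepSpace hA) :=
  (volume : Measure (EuclideanSpace ℝ (Fin n))).prod (badicMeasure hA)

/-- Multiplication by `A` on the representation space. -/
def mulRep (p : RepSpace hA) : RepSpace hA :=
  (WithLp.toLp 2 ((A.map (Rat.cast : ℚ → ℝ)).mulVec p.1.ofLp), mulBadic hA p.2)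

/-- The inclusion of `ℤⁿ[A]` into `ℤⁿ(A)`. -/
def inclLaurent (x : polyLattice A) : Laurent hA :=
  (⟨x.1, polyLattice_le_laurentLattice A x.2⟩ : laurentLattice A)

/-- The diagonal embedding `φ x = (x, x)` of `ℤⁿ(A)` into the representation space. -/
def diag (x : Laurent hA) : RepSpace hA :=
  (WithLp.toLp 2 fun i => ((Laurent.vec hA x i : ℚ) : ℝ), (x : BadicSeries hA))

/-- `F` is a self-affine set of `(A, D)`: a nonempty compact subset of the representation space
with `A F = ⋃_{d ∈ D} (F + φ(d))`. -/
def IsSelfAffineSet (D : Finset (polyLattice A)) (F : Set (RepSpace hA)) : Prop :=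
  F.Nonempty ∧ IsCompact F ∧
    mulRep hA '' F = ⋃ d ∈ D, (fun p => p + diag hA (inclLaurent hA d)) '' F

end Valuation

/-- `(A, D)` is a digit system: `A` is expanding and `D ⊆ ℤⁿ[A]` has `|ℤⁿ[A] / A ℤⁿ[A]|`
elements. -/
def IsDigitSystem (A : Matrix (Fin n) (Fin n) ℚ) (D : Finset (polyLattice A)) : Prop :=
  IsExpanding A ∧ D.card = residueCard A

/-- The expansion `d₀ + A d₁ + ⋯ + A ^ (k - 1) d_{k - 1}`. -/
def expansion {A : Matrix (Fin n) (Fin n) ℚ} {D : Finset (polyLattice A)} {k : ℕ}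
    (d : Fin k → D) : polyLattice A :=
  ∑ i : Fin k, (mulPoly A)^[i] (d i)

/-- The set `D_k` of all expansions of length `k`. -/
def digitBlocks {A : Matrix (Fin n) (Fin n) ℚ} (D : Finset (polyLattice A)) (k : ℕ) :
    Set (polyLattice A) :=
  Set.range fun d : Fin k → D => expansion d

/-- The set `D_∞`, the union of the `D_k` with `k ≥ 1`. -/
def digitBlocksInf {A : Matrix (Fin n) (Fin n) ℚ} (D : Finset (polyLattice A)) :
    Set (polyLattice A) :=
  ⋃ k ≥ 1, digitBlocks D k

/-- A set is uniformly discrete if, for some `r > 0`, every open ball of radius `r` contains at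
most one of its points. -/
def IsUniformlyDiscrete {X : Type*} [PseudoMetricSpace X] (M : Set X) : Prop :=
  ∃ r > 0, ∀ c : X, (Metric.ball c r ∩ M).Subsingleton

end RationalTile

end

/-! The inverse of multiplication by `A` on the representation space contracts both factors: `A⁻¹`
has spectral radius below 1 on ℝⁿ, and it shrinks the B-adic norm. Every nonempty compact solution
`F` of the set equation is therefore the set of all series ∑ A^(-k-1) φ(d_k) with digits d_k in `D`,
which gives existence and uniqueness.

Positivity of the measure rests on two facts. First, `A` multiplies μ by exactly a
(`repMeasure_image`): the factor is |det A| on ℝⁿ and b on ℤⁿ((B)), and a = |det A| b by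
`residueCard_eq`. Second, φ(ℤⁿ[A]) is a discrete subgroup (`exists_le_norm_diagPoly`), so the
uniform discreteness condition holds for every digit set. Both facts depend on ℤⁿ[A] ∩ ℤⁿ[A⁻¹]
having bounded denominators, which is a Noetherian argument (`exists_truncLattice_descent`).

If μ(F) > 0, then A^k F is covered by the translates of F by the points of φ(D_k), so a^k μ(F) ≤
|D_k| μ(F), and no two expansions of length k coincide (`IsAttractor.digitSum_injective`).
Conversely, distinctness and separation give a^k disjoint balls of one fixed radius around φ(D_k).
For large k, A^(-k) carries them all into the ε-neighbourhood of F, whose measure is thus at least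
that of one ball. Letting ε tend to 0 yields μ(F) > 0 (`IsAttractor.measure_pos`). -/

noncomputable section

namespace RationalTile

/-! ### Self-affine sets of contracting systems on normed groups -/

section SelfAffine

open Filter Topology

variable {G : Type*} [NormedAddCommGroup G] {ι : Type*}

/-- The iterates of `S` contract at a geometric rate. -/
def IsContracting (S : G → G) : Prop :=
  ∃ C θ : ℝ, 0 ≤ C ∧ 0 ≤ θ ∧ θ < 1 ∧ ∀ (k : ℕ) (x : G), ‖S^[k] x‖ ≤ C * θ ^ k * ‖x‖

theorem IsContracting.tendsto_iterate {S : G → G} (hS : IsContracting S) {x : ℕ → G} {R : ℝ}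
    (hx : ∀ k, ‖x k‖ ≤ R) : Tendsto (fun k => S^[k] (x k)) atTop (𝓝 0) := by
  obtain ⟨C, θ, hC, h0, h1, h⟩ := hS
  refine squeeze_zero_norm (a := fun k => C * θ ^ k * R) (fun k => ?_) ?_
  · exact (h k _).trans (mul_le_mul_of_nonneg_left (hx k) (by positivity))
  · simpa using ((tendsto_pow_atTop_nhds_zero_of_lt_one h0 h1).const_mul C).mul_const R

/-- The series `∑ A ^ (-(k + 1)) δ(d k)` attached to a sequence of digits. -/
def digitSeries (A : G ≃+ G) (δ : ι → G) (d : ℕ → ι) : G :=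
  ∑' k : ℕ, A.symm^[k + 1] (δ (d k))

/-- The finite sum `∑ A ^ i δ(d i)`. -/
def digitSum (A : G ≃+ G) (δ : ι → G) {k : ℕ} (d : Fin k → ι) : G :=
  ∑ i : Fin k, A^[i] (δ (d i))

/-- The nonempty compact solutions `F` of `A F = ⋃ i, (F + δ i)`. -/
def IsAttractor (A : G ≃+ G) (δ : ι → G) (F : Set G) : Prop :=
  F.Nonempty ∧ IsCompact F ∧ A '' F = ⋃ i, (fun p => p + δ i) '' F

variable {A : G ≃+ G} {δ : ι → G}

theorem digitSum_succ {k : ℕ} (d : Fin (k + 1) → ι) :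
    digitSum A δ d = δ (d 0) + A (digitSum A δ (Fin.tail d)) := by
  unfold digitSum
  rw [Fin.sum_univ_succ, map_sum]
  simp only [Fin.val_zero, Function.iterate_zero, id_eq, Fin.val_succ, Fin.tail,
    Function.iterate_succ_apply']

theorem iterate_add (f : G ≃+ G) (k : ℕ) (x y : G) : f^[k] (x + y) = f^[k] x + f^[k] y :=
  iterate_map_add f k x y

theorem iterate_iterate_symm (k : ℕ) (x : G) : A^[k] (A.symm^[k] x) = x :=
  Function.LeftInverse.iterate A.apply_symm_apply k x

theorem IsAttractor.exists_iterate {F : Set G} (hF : IsAttractor A δ F) (k : ℕ) {x : G}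
    (hx : x ∈ F) : ∃ d : Fin k → ι, ∃ y ∈ F, A^[k] x = y + digitSum A δ d := by
  induction k with
  | zero => exact ⟨Fin.elim0, x, hx, by simp [digitSum]⟩
  | succ k ih =>
    obtain ⟨d, y, hy, h⟩ := ih
    have : A y ∈ ⋃ i, (fun p => p + δ i) '' F := hF.2.2 ▸ Set.mem_image_of_mem A hy
    obtain ⟨i, z, hz, hzi⟩ := Set.mem_iUnion.1 this
    refine ⟨Fin.cons i d, z, hz, ?_⟩
    rw [Function.iterate_succ_apply', h, map_add, digitSum_succ, Fin.cons_zero, Fin.tail_cons,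
      ← hzi, add_assoc]

theorem IsAttractor.symm_mem {F : Set G} (hF : IsAttractor A δ F) {y : G} (hy : y ∈ F) (i : ι) :
    A.symm (y + δ i) ∈ F := by
  have : y + δ i ∈ A '' F := hF.2.2 ▸ Set.mem_iUnion.2 ⟨i, y, hy, rfl⟩
  obtain ⟨z, hz, hzy⟩ := this
  rwa [← hzy, A.symm_apply_apply]

theorem IsAttractor.iterate_symm_mem {F : Set G} (hF : IsAttractor A δ F) {k : ℕ}
    (d : Fin k → ι) {y : G} (hy : y ∈ F) : A.symm^[k] (y + digitSum A δ d) ∈ F := by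
  induction k generalizing y with
  | zero => simpa [digitSum] using hy
  | succ k ih =>
    -- The digit `d 0` meets the first inverse step, so it is absorbed into the base point; hence
    -- the induction generalizes over `y`.
    have := ih (Fin.tail d) (hF.symm_mem hy (d 0))
    rwa [digitSum_succ, Function.iterate_succ_apply, ← add_assoc, map_add, A.symm_apply_apply]

theorem norm_le_of_finite [Finite ι] (δ : ι → G) : ∃ R, 0 ≤ R ∧ ∀ i, ‖δ i‖ ≤ R := by
  obtain ⟨R, hR⟩ := (Set.finite_range fun i => ‖δ i‖).bddAbove
  exact ⟨max R 0, le_max_right _ _, fun i => (hR ⟨i, rfl⟩).trans (le_max_left _ _)⟩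

/-- A majorant independent of the digit sequence serves twice: for summability, and as a Weierstrass
bound making `digitSeries` continuous in the digits. -/
theorem exists_summable_bound [Finite ι] (hc : IsContracting A.symm) (δ : ι → G) :
    ∃ u : ℕ → ℝ, Summable u ∧ ∀ k i, ‖A.symm^[k + 1] (δ i)‖ ≤ u k := by
  obtain ⟨R, hR0, hR⟩ := norm_le_of_finite δ
  obtain ⟨C, θ, hC, h0, h1, h⟩ := hc
  refine ⟨fun k => C * θ ^ (k + 1) * R, ?_, fun k i => (h _ _).trans
    (mul_le_mul_of_nonneg_left (hR i) (by positivity))⟩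
  exact (((summable_nat_add_iff 1).2 (summable_geometric_of_lt_one h0 h1)).mul_left C).mul_right R

variable [CompleteSpace G]

theorem summable_digitSeries [Finite ι] (hc : IsContracting A.symm) (d : ℕ → ι) :
    Summable fun k : ℕ => A.symm^[k + 1] (δ (d k)) := by
  obtain ⟨u, hu, h⟩ := exists_summable_bound hc δ
  exact Summable.of_norm_bounded hu fun k => h k _

/-- A bounded remainder is killed by the contraction, so an orbit staying in a compact `F` has the
same limit as the bare partial sums. -/
theorem tendsto_digitSeries [Finite ι] (hc : IsContracting A.symm) (d : ℕ → ι) {x : ℕ → G}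
    {R : ℝ} (hx : ∀ k, ‖x k‖ ≤ R) :
    Tendsto (fun k => ∑ i ∈ Finset.range k, A.symm^[i + 1] (δ (d i)) + A.symm^[k] (x k)) atTop
      (𝓝 (digitSeries A δ d)) := by
  have := (summable_digitSeries (δ := δ) hc d).hasSum.tendsto_sum_nat.add (hc.tendsto_iterate hx)
  rwa [add_zero] at this

theorem isCompact_range_digitSeries [Finite ι] (hc : IsContracting A.symm) :
    IsCompact (Set.range (digitSeries A δ)) := by
  -- With the finite set of digits discrete, the space of digit sequences is compact by Tychonoff.
  let : TopologicalSpace ι := ⊥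
  have : DiscreteTopology ι := ⟨rfl⟩
  obtain ⟨u, hu, h⟩ := exists_summable_bound hc δ
  refine isCompact_range (continuous_tsum (fun k => ?_) hu fun k d => h k _)
  exact (continuous_of_discreteTopology (f := fun i : ι => A.symm^[k + 1] (δ i))).comp
    (continuous_apply k)

theorem apply_digitSeries [Finite ι] (hc : IsContracting A.symm) (hA : Continuous A)
    (d : ℕ → ι) : A (digitSeries A δ d) = digitSeries A δ (fun k => d (k + 1)) + δ (d 0) := by
  have hs := summable_digitSeries (δ := δ) hc d
  unfold digitSeries
  rw [hs.map_tsum A hA]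
  have h1 : ∀ k, A (A.symm^[k + 1] (δ (d k))) = A.symm^[k] (δ (d k)) := fun k => by
    rw [Function.iterate_succ_apply', A.apply_symm_apply]
  simp only [h1]
  rw [Summable.tsum_eq_zero_add, add_comm]
  · rfl
  · simpa only [Function.comp_def, h1] using hs.map A hA

theorem isAttractor_range_digitSeries [Finite ι] [Nonempty ι] (hc : IsContracting A.symm)
    (hA : Continuous A) : IsAttractor A δ (Set.range (digitSeries A δ)) := by
  refine ⟨Set.range_nonempty _, isCompact_range_digitSeries hc, ?_⟩
  ext x
  simp only [Set.mem_image, Set.mem_range, Set.mem_iUnion, exists_exists_eq_and]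
  constructor
  · rintro ⟨d, rfl⟩
    exact ⟨d 0, _, (apply_digitSeries hc hA d).symm⟩
  · rintro ⟨i, d, rfl⟩
    exact ⟨fun k => Nat.casesOn k i d, apply_digitSeries hc hA _⟩

theorem IsAttractor.mem_of_digitSeries [Finite ι] {F : Set G} (hF : IsAttractor A δ F)
    (hc : IsContracting A.symm) (d : ℕ → ι) : digitSeries A δ d ∈ F := by
  obtain ⟨y, hy⟩ := hF.1
  -- Stated for all sequences at once, because the inductive step removes `d 0` and shifts the rest.
  have hmem : ∀ (k : ℕ) (d : ℕ → ι),
      ∑ i ∈ Finset.range k, A.symm^[i + 1] (δ (d i)) + A.symm^[k] y ∈ F := by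
    intro k
    induction k with
    | zero => exact fun _ => by simpa using hy
    | succ k ih =>
      intro d
      have := hF.symm_mem (ih fun k => d (k + 1)) (d 0)
      rw [map_add, map_add, map_sum] at this
      rw [Finset.sum_range_succ']
      simp only [Function.iterate_succ_apply', Function.iterate_zero, id_eq] at this ⊢
      rwa [add_right_comm] at this
  refine hF.2.1.isClosed.mem_of_tendsto
    (b := atTop) (f := fun k => ∑ i ∈ Finset.range k, A.symm^[i + 1] (δ (d i)) + A.symm^[k] y)
    ?_ (Eventually.of_forall fun k => hmem k d)
  exact tendsto_digitSeries hc d (x := fun _ => y) fun _ => le_rfl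

/-- Following an orbit y_k of `x` inside `F`, with A y_k = y_(k+1) + δ(d_k), records the digits of
`x`. -/
theorem IsAttractor.exists_digitSeries [Finite ι] {F : Set G} (hF : IsAttractor A δ F)
    (hc : IsContracting A.symm) {x : G} (hx : x ∈ F) : ∃ d, digitSeries A δ d = x := by
  have hstep : ∀ y : F, ∃ p : ι × F, A y = p.2 + δ p.1 := by
    intro y
    have : A y ∈ ⋃ i, (fun p => p + δ i) '' F := hF.2.2 ▸ Set.mem_image_of_mem A y.2
    obtain ⟨i, z, hz, hzi⟩ := Set.mem_iUnion.1 this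
    exact ⟨⟨i, z, hz⟩, hzi.symm⟩
  choose p hp using hstep
  let y : ℕ → F := fun k => (fun z => (p z).2)^[k] ⟨x, hx⟩
  have hy : ∀ k, A (y k) = y (k + 1) + δ (p (y k)).1 := fun k => by
    simp only [y, Function.iterate_succ_apply']
    exact hp _
  have hsum : ∀ k, ∑ i ∈ Finset.range k, A.symm^[i + 1] (δ (p (y i)).1) + A.symm^[k] (y k)
      = x := by
    intro k
    induction k with
    | zero => simp [y]
    | succ k ih =>
      rw [Finset.sum_range_succ, add_assoc, ← iterate_add, add_comm (δ _), ← hy,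
        Function.iterate_succ_apply, A.symm_apply_apply, ih]
  obtain ⟨R, hR⟩ := hF.2.1.isBounded.exists_norm_le
  refine ⟨fun k => (p (y k)).1, tendsto_nhds_unique (tendsto_digitSeries hc _
    (x := fun k => (y k : G)) fun k => hR _ (y k).2) ?_⟩
  simp only [hsum]
  exact tendsto_const_nhds

theorem existsUnique_isAttractor [Finite ι] [Nonempty ι] (hc : IsContracting A.symm)
    (hA : Continuous A) : ∃! F, IsAttractor A δ F := by
  refine ⟨_, isAttractor_range_digitSeries hc hA, fun F hF => ?_⟩
  ext x
  constructor
  · exact fun hx => hF.exists_digitSeries hc hx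
  · rintro ⟨d, rfl⟩
    exact hF.mem_of_digitSeries hc d

end SelfAffine

/-! ### Positive measure, distinct expansions and packing of balls -/

section Measure

open Filter Topology Metric

theorem measure_image_iterate {G : Type*} [NormedAddCommGroup G] {A : G ≃+ G}
    [MeasurableSpace G] {μ : Measure G} {a : ENNReal} (hμ : ∀ s, μ (A '' s) = a * μ s) (k : ℕ)
    (s : Set G) :    μ (A^[k] '' s) = a ^ k * μ s := by
  induction k with
  | zero => simp
  | succ k ih => rw [Function.iterate_succ', Set.image_comp, hμ, ih, pow_succ', mul_assoc]

variable {G : Type*} [NormedAddCommGroup G] {ι : Type*} [Fintype ι] {A : G ≃+ G} {δ : ι → G}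
  [MeasurableSpace G] [BorelSpace G] {μ : Measure G} [μ.IsAddHaarMeasure]

/-- A coincidence among digit sums would cover A^k F, of measure |ι|^k μ(F), by fewer than |ι|^k
translates of F. This is impossible, since 0 < μ(F) < ∞. -/
theorem IsAttractor.digitSum_injective {F : Set G} (hF : IsAttractor A δ F)
    (hμ : ∀ s, μ (A '' s) = Fintype.card ι * μ s) (hpos : 0 < μ F) (k : ℕ) :
    Function.Injective fun d : Fin k → ι => digitSum A δ d := by
  classical
  set E : Finset G := Finset.univ.image fun d : Fin k → ι => digitSum A δ d
  have hsub : A^[k] '' F ⊆ ⋃ e ∈ E, (fun p => p + e) '' F := by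
    rintro _ ⟨x, hx, rfl⟩
    obtain ⟨d, y, hy, h⟩ := hF.exists_iterate k hx
    exact Set.mem_biUnion (Finset.mem_image_of_mem _ (Finset.mem_univ d)) ⟨y, hy, h.symm⟩
  have hle : (Fintype.card ι : ENNReal) ^ k * μ F ≤ E.card * μ F := by
    rw [← measure_image_iterate hμ]
    refine (measure_mono hsub).trans ((measure_biUnion_finset_le _ _).trans ?_)
    simp [measure_preimage_add_right]
  have hfin : μ F ≠ ⊤ := hF.2.1.measure_lt_top.ne
  rw [ENNReal.mul_le_mul_iff_left hpos.ne' hfin] at hle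
  have hcard : Fintype.card (Fin k → ι) ≤ E.card := by
    rw [Fintype.card_fun, Fintype.card_fin]
    exact_mod_cast hle
  have : Set.InjOn (fun d : Fin k → ι => digitSum A δ d) (Finset.univ : Finset (Fin k → ι)) :=
    Finset.card_image_iff.1 (le_antisymm Finset.card_image_le hcard)
  simpa using this

/-- The disjoint balls have total measure |ι|^k times that of one ball, and `A.symm^[k]` divides
measure by the same factor while moving them close to `F`. So every closed ε-neighbourhood of `F`
has at least the measure of one ball. -/
theorem IsAttractor.measure_pos [LocallyCompactSpace G] {F : Set G} (hF : IsAttractor A δ F)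
    (hc : IsContracting A.symm) (hμ : ∀ s, μ (A '' s) = Fintype.card ι * μ s) [Nonempty ι]
    (hinj : ∀ k, 1 ≤ k → Function.Injective fun d : Fin k → ι => digitSum A δ d)
    {r : ℝ} (hr : 0 < r) (hsep : ∀ k, 1 ≤ k → ∀ d e : Fin k → ι,
      digitSum A δ d ≠ digitSum A δ e →
        Disjoint (ball (digitSum A δ d) r) (ball (digitSum A δ e) r)) :
    0 < μ F := by
  have hball : 0 < μ (ball (0 : G) r) := measure_ball_pos μ 0 hr
  obtain ⟨y, hy⟩ := hF.1
  have hcard : (Fintype.card ι : ENNReal) ≠ 0 := by simp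
  have key : ∀ ε > 0, μ (ball (0 : G) r) ≤ μ (cthickening ε F) := by
    intro ε hε
    -- The bound r + ‖y‖ covers z - (y + e) for z in the ball of radius r around a digit sum e.
    -- Positive k is needed because injectivity and separation are assumed only there.
    obtain ⟨k, hk1, hk⟩ : ∃ k, 1 ≤ k ∧ ∀ z, ‖z‖ ≤ r + ‖y‖ → ‖A.symm^[k] z‖ ≤ ε := by
      obtain ⟨C, θ, hC, h0, h1, h⟩ := hc
      have : Tendsto (fun k => C * θ ^ k * (r + ‖y‖)) atTop (𝓝 0) := by
        simpa using ((tendsto_pow_atTop_nhds_zero_of_lt_one h0 h1).const_mul C).mul_const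
          (r + ‖y‖)
      obtain ⟨k, hk⟩ := ((this.eventually_le_const hε).and (eventually_ge_atTop 1)).exists
      exact ⟨k, hk.2, fun z hz => (h k z).trans
        ((mul_le_mul_of_nonneg_left hz (by positivity)).trans hk.1)⟩
    have hmeas : μ (⋃ d : Fin k → ι, ball (digitSum A δ d) r)
        = (Fintype.card ι : ENNReal) ^ k * μ (ball (0 : G) r) := by
      rw [measure_iUnion (fun d e hde => hsep k hk1 d e fun h => hde (hinj k hk1 h))
        fun _ => measurableSet_ball]
      simp [Measure.addHaar_ball_center, tsum_fintype]
    have hsub : (⋃ d : Fin k → ι, ball (digitSum A δ d) r) ⊆ A^[k] '' cthickening ε F := by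
      intro z hz
      obtain ⟨d, hd⟩ := Set.mem_iUnion.1 hz
      refine ⟨A.symm^[k] z, ?_, iterate_iterate_symm k z⟩
      refine mem_cthickening_of_dist_le _ _ _ _ (hF.iterate_symm_mem d hy) ?_
      rw [dist_eq_norm, ← iterate_map_sub A.symm]
      refine hk _ ?_
      have h1 : ‖z - digitSum A δ d‖ ≤ r := by
        rw [← dist_eq_norm]
        exact (mem_ball.1 hd).le
      calc ‖z - (y + digitSum A δ d)‖ = ‖(z - digitSum A δ d) - y‖ := by congr 1; abel
        _ ≤ _ := (norm_sub_le _ _).trans (by linarith)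
    have := measure_mono (μ := μ) hsub
    rw [hmeas, measure_image_iterate hμ] at this
    exact (ENNReal.mul_le_mul_iff_right (pow_ne_zero _ hcard)
      (ENNReal.pow_ne_top (ENNReal.natCast_ne_top _))).1 this
  -- Local compactness makes some closed thickening compact, hence of finite measure, so continuity
  -- from above applies.
  have hlim : Tendsto (fun ε => μ (cthickening ε F)) (𝓝[>] 0) (𝓝 (μ F)) := by
    refine (tendsto_measure_cthickening_of_isClosed ?_ hF.2.1.isClosed).mono_left
      nhdsWithin_le_nhds
    obtain ⟨ε, hε, h⟩ := hF.2.1.exists_isCompact_cthickening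
    exact ⟨ε, hε, h.measure_lt_top.ne⟩
  exact hball.trans_le (ge_of_tendsto hlim (eventually_mem_nhdsWithin.mono key))

end Measure

/-! ### Bounded denominators of ℤⁿ[M] ∩ ℤⁿ[M⁻¹] -/

section Lattice

variable {n : ℕ}

/-- The sum `ℤⁿ + M ℤⁿ + ⋯ + M ^ (k - 1) ℤⁿ`. -/
def truncLattice (M : Matrix (Fin n) (Fin n) ℚ) : ℕ → AddSubgroup (Fin n → ℚ)
  | 0 => ⊥
  | k + 1 => truncLattice M k ⊔ (intLattice n).map (act (M ^ k))

theorem truncLattice_mono (M : Matrix (Fin n) (Fin n) ℚ) : Monotone (truncLattice M) :=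
  monotone_nat_of_le_succ fun _ => le_sup_left

theorem map_intLattice_le_truncLattice (M : Matrix (Fin n) (Fin n) ℚ) {i k : ℕ} (h : i < k) :
    (intLattice n).map (act (M ^ i)) ≤ truncLattice M k :=
  le_trans (b := truncLattice M (i + 1)) le_sup_right (truncLattice_mono M h)

theorem act_act (M N : Matrix (Fin n) (Fin n) ℚ) (v : Fin n → ℚ) :
    act M (act N v) = act (M * N) v := by
  rw [act_mul]; rfl

theorem act_truncLattice {M : Matrix (Fin n) (Fin n) ℚ} {k : ℕ} {v : Fin n → ℚ}
    (hv : v ∈ truncLattice M k) : act M v ∈ truncLattice M (k + 1) := by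
  have h : (truncLattice M k).map (act M) ≤ truncLattice M (k + 1) := by
    clear hv
    induction k with
    | zero => simp [truncLattice]
    | succ k ih =>
      change (truncLattice M k ⊔ (intLattice n).map (act (M ^ k))).map (act M) ≤ _
      rw [AddSubgroup.map_sup, AddSubgroup.map_map, ← act_mul, ← pow_succ']
      exact sup_le (ih.trans (truncLattice_mono M (Nat.le_succ _)))
        (map_intLattice_le_truncLattice M (by lia))
  exact h ⟨v, hv, rfl⟩

theorem act_pow_truncLattice {M : Matrix (Fin n) (Fin n) ℚ} {k : ℕ} {v : Fin n → ℚ}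
    (hv : v ∈ truncLattice M k) (j : ℕ) : act (M ^ j) v ∈ truncLattice M (k + j) := by
  induction j with
  | zero => simpa [act_one] using hv
  | succ j ih =>
    rw [pow_succ', ← act_act]
    exact act_truncLattice ih

theorem exists_mem_truncLattice {M : Matrix (Fin n) (Fin n) ℚ} {v : Fin n → ℚ}
    (hv : v ∈ polyLattice M) : ∃ k, v ∈ truncLattice M k := by
  have h : polyLattice M ≤ ⨆ k, truncLattice M k := iSup_le fun k =>
    (map_intLattice_le_truncLattice M (Nat.lt_succ_self k)).trans (le_iSup (truncLattice M) _)
  exact (AddSubgroup.mem_iSup_of_directed (truncLattice_mono M).directed_le).1 (h hv)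

/-- Only finitely many negative powers of `M` occur in `v`; a large M^k clears them and leaves no
exponent above k. -/
theorem exists_act_pow_mem_truncLattice {M : Matrix (Fin n) (Fin n) ℚ} (hM : IsUnit M.det)
    {v : Fin n → ℚ} (hv : v ∈ polyLattice M⁻¹) : ∃ k, act (M ^ k) v ∈ truncLattice M (k + 1) := by
  obtain ⟨k, hk⟩ := exists_mem_truncLattice hv
  have h : ∀ i ≤ k, (truncLattice M⁻¹ i).map (act (M ^ k)) ≤ truncLattice M (k + 1) := by
    intro i
    induction i with
    | zero => simp [truncLattice]
    | succ i ih =>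
      intro hi
      change (truncLattice M⁻¹ i ⊔ (intLattice n).map (act (M⁻¹ ^ i))).map (act _) ≤ _
      rw [AddSubgroup.map_sup, AddSubgroup.map_map, ← act_mul, Matrix.inv_pow',
        ← Matrix.pow_sub' M hM (by lia)]
      exact sup_le (ih (by lia)) (map_intLattice_le_truncLattice M (by lia))
  exact ⟨k, h k le_rfl ⟨v, hk, rfl⟩⟩

/-- The inclusion of `Fin n → ℤ` into `Fin n → ℚ`. -/
def intCastVec (n : ℕ) : (Fin n → ℤ) →+ (Fin n → ℚ) where
  toFun z i := z i
  map_zero' := by ext; simp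
  map_add' x y := by ext; simp

theorem mem_intLattice_iff {v : Fin n → ℚ} : v ∈ intLattice n ↔ ∃ z, intCastVec n z = v := by
  constructor
  · intro h
    choose z hz using h
    exact ⟨z, funext fun i => (hz i).symm⟩
  · rintro ⟨z, rfl⟩ i
    exact ⟨z i, rfl⟩

/-- The integer vectors z with M^k z already in `truncLattice M k` form an ascending chain of
subgroups of ℤⁿ, which stabilizes. If v has top term M^k z and M v needs no power beyond M^k, then z
lies in the (k+1)-st group, hence in the k-th, and the top term of v is redundant. -/
theorem exists_truncLattice_descent (M : Matrix (Fin n) (Fin n) ℚ) :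
    ∃ k₀, ∀ k ≥ k₀, ∀ v ∈ truncLattice M (k + 1), act M v ∈ truncLattice M (k + 1) →
      v ∈ truncLattice M k := by
  let N : ℕ →o Submodule ℤ (Fin n → ℤ) :=
    { toFun := fun k => AddSubgroup.toIntSubmodule
        ((truncLattice M k).comap ((act (M ^ k)).comp (intCastVec n)))
      monotone' := monotone_nat_of_le_succ fun k z hz => by
        change act (M ^ (k + 1)) (intCastVec n z) ∈ truncLattice M (k + 1)
        rw [pow_succ', ← act_act]
        exact act_truncLattice hz }
  obtain ⟨k₀, hk₀⟩ := monotone_stabilizes_iff_noetherian.2 inferInstance N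
  refine ⟨k₀, fun k hk v hv hMv => ?_⟩
  obtain ⟨v', hv', w, ⟨u, hu, rfl⟩, rfl⟩ := AddSubgroup.mem_sup.1 hv
  obtain ⟨z, rfl⟩ := mem_intLattice_iff.1 hu
  rw [map_add, add_mem_cancel_left (act_truncLattice hv'), act_act, ← pow_succ'] at hMv
  have hz : z ∈ N (k + 1) := hMv
  rw [← hk₀ _ (by lia), hk₀ k hk] at hz
  exact add_mem hv' hz

theorem exists_inf_le_truncLattice {M : Matrix (Fin n) (Fin n) ℚ} (hM : IsUnit M.det) :
    ∃ k, polyLattice M ⊓ polyLattice M⁻¹ ≤ truncLattice M k := by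
  obtain ⟨k₀, hk₀⟩ := exists_truncLattice_descent M
  refine ⟨k₀ + 1, fun v ⟨hv, hv'⟩ => ?_⟩
  have hstep : ∀ k ≥ k₀ + 1, v ∈ truncLattice M (k + 1) → v ∈ truncLattice M k := by
    intro k hk hvk
    -- Membership of `v` in ℤⁿ[M⁻¹] bounds M^j v for some j. Descent then passes from M^(j+1) v to
    -- M^j v, one truncation level at a time, until it reaches `v` itself.
    obtain ⟨j, hj⟩ := exists_act_pow_mem_truncLattice hM hv'
    have hj' := truncLattice_mono M (show j + 1 ≤ k + j by lia) hj
    clear hj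
    induction j with
    | zero => simpa [act_one] using hj'
    | succ j ih =>
      refine ih (hk₀ _ (by lia) _ ?_ ?_)
      · have := act_pow_truncLattice hvk j
        rwa [add_right_comm] at this
      · rwa [act_act, ← pow_succ']
  obtain ⟨k, hk⟩ := exists_mem_truncLattice hv
  have hdesc : ∀ j, v ∈ truncLattice M (k₀ + 1 + j) → v ∈ truncLattice M (k₀ + 1) := by
    intro j
    induction j with
    | zero => exact id
    | succ j ih => exact fun h => ih (hstep _ (by lia) h)
  exact hdesc k (truncLattice_mono M (by lia) hk)

theorem exists_nsmul_truncLattice (M : Matrix (Fin n) (Fin n) ℚ) (k : ℕ) :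
    ∃ m : ℕ, m ≠ 0 ∧ ∀ v ∈ truncLattice M k, m • v ∈ intLattice n := by
  induction k with
  | zero =>
    refine ⟨1, one_ne_zero, fun v hv => ?_⟩
    rw [AddSubgroup.mem_bot.1 hv, smul_zero]
    exact zero_mem _
  | succ k ih =>
    obtain ⟨m, hm, h⟩ := ih
    obtain ⟨m', hm', hmul⟩ := exists_int_matrix (M ^ k)
    refine ⟨m * m', mul_ne_zero hm hm', fun v hv => ?_⟩
    obtain ⟨w, hw, _, ⟨u, hu, rfl⟩, rfl⟩ := AddSubgroup.mem_sup.1 hv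
    rw [smul_add]
    refine add_mem ?_ ?_
    · rw [mul_comm, mul_smul]
      exact nsmul_mem (h w hw) _
    · rw [mul_smul]
      exact nsmul_mem (hmul u hu) _

/-- The group `ℤⁿ[M] ∩ ℤⁿ[M⁻¹]` has bounded denominators. -/
theorem exists_nsmul_inf_polyLattice {M : Matrix (Fin n) (Fin n) ℚ} (hM : IsUnit M.det) :
    ∃ m : ℕ, m ≠ 0 ∧ ∀ v ∈ polyLattice M ⊓ polyLattice M⁻¹, m • v ∈ intLattice n := by
  obtain ⟨k, hk⟩ := exists_inf_le_truncLattice hM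
  obtain ⟨m, hm, h⟩ := exists_nsmul_truncLattice M k
  exact ⟨m, hm, fun v hv => h v (hk hv)⟩

/-! ### Indices and determinants -/

theorem act_injective {M : Matrix (Fin n) (Fin n) ℚ} (hM : IsUnit M.det) :
    Function.Injective (act M) := by
  simpa using act_zpow_injective hM 1

theorem map_act_mul (M N : Matrix (Fin n) (Fin n) ℚ) (H : AddSubgroup (Fin n → ℚ)) :
    H.map (act (M * N)) = (H.map (act N)).map (act M) := by
  rw [act_mul, AddSubgroup.map_map]

theorem map_act_one (H : AddSubgroup (Fin n → ℚ)) : H.map (act 1) = H := by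
  rw [act_one, AddSubgroup.map_id]

theorem intLattice_eq_closure (n : ℕ) :
    intLattice n = AddSubgroup.closure (Set.range (Pi.basisFun ℚ (Fin n))) := by
  refine le_antisymm (fun v hv => ?_) ?_
  · obtain ⟨z, rfl⟩ := mem_intLattice_iff.1 hv
    have : intCastVec n z = ∑ i, z i • Pi.basisFun ℚ (Fin n) i := by
      ext j
      simp [intCastVec, Finset.sum_apply, Pi.single_apply]
    rw [this]
    exact sum_mem fun i _ => zsmul_mem (AddSubgroup.subset_closure (Set.mem_range_self i)) _
  · rw [AddSubgroup.closure_le]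
    rintro _ ⟨i, rfl⟩
    refine mem_intLattice_iff.2 ⟨Pi.single i 1, ?_⟩
    ext j
    simp [intCastVec, Pi.single_apply]

theorem relIndex_map_intLattice_of_le {M : Matrix (Fin n) (Fin n) ℚ} (hM : IsUnit M.det)
    (h : (intLattice n).map (act M) ≤ intLattice n) :
    (((intLattice n).map (act M)).relIndex (intLattice n) : ℚ) = |M.det| := by
  let e : (Fin n → ℚ) ≃ₗ[ℚ] (Fin n → ℚ) := Matrix.toLin'OfInv
    (Matrix.nonsing_inv_mul M hM) (Matrix.mul_nonsing_inv M hM)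
  have he' : ∀ i, (Pi.basisFun ℚ (Fin n)).map e i = act M (Pi.basisFun ℚ (Fin n) i) := by
    intro i
    simp [e, act, Matrix.toLin'OfInv]
  have he : ∀ i, (Pi.basisFun ℚ (Fin n)).map e i = M.mulVec (Pi.single i 1) := by
    intro i
    rw [he', Pi.basisFun_apply]
    rfl
  rw [AddSubgroup.relIndex_eq_abs_det _ _ h ((Pi.basisFun ℚ (Fin n)).map e)
    (Pi.basisFun ℚ (Fin n)) ?_ (intLattice_eq_closure n)]
  -- The basis determinant takes the vectors as rows, whereas the images of the unit vectors are the
  -- columns of `M`.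
  · rw [Pi.basisFun_det_apply, ← Matrix.det_transpose M]
    congr 2
    ext i j
    rw [Matrix.of_apply, he, Matrix.mulVec_single_one, Matrix.col_apply, Matrix.transpose_apply]
  · rw [intLattice_eq_closure, AddMonoidHom.map_closure, ← Set.range_comp]
    exact congrArg _ (congrArg _ (funext fun i => (he' i).symm))

theorem relIndex_map_intLattice {M N : Matrix (Fin n) (Fin n) ℚ} (hM : IsUnit M.det)
    (hN : IsUnit N.det) (h : (intLattice n).map (act M) ≤ (intLattice n).map (act N)) :
    (((intLattice n).map (act M)).relIndex ((intLattice n).map (act N)) : ℚ) =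
      |M.det| / |N.det| := by
  have hM' : M = N * (N⁻¹ * M) := by rw [← mul_assoc, Matrix.mul_nonsing_inv _ hN, one_mul]
  have hdet : (N⁻¹ * M).det = M.det / N.det := by
    rw [Matrix.det_mul, Matrix.det_nonsing_inv, Ring.inverse_eq_inv', mul_comm, div_eq_mul_inv]
  rw [hM', map_act_mul] at h
  have h' := (AddSubgroup.map_le_map_iff_of_injective (act_injective hN)).1 h
  conv_lhs =>
    rw [hM', map_act_mul, AddSubgroup.relIndex_map_map_of_injective _ _ (act_injective hN)]
  rw [relIndex_map_intLattice_of_le ?_ h', hdet, abs_div]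
  rw [hdet, isUnit_iff_ne_zero]
  exact div_ne_zero hM.ne_zero hN.ne_zero

theorem relIndex_map_polyLattice (M : Matrix (Fin n) (Fin n) ℚ) :
    ((polyLattice M).map (act M)).relIndex (polyLattice M) = residueCard M := by
  unfold residueCard
  rw [← AddSubgroup.index_eq_card, AddSubgroup.relIndex]
  congr 1
  ext x
  rw [AddSubgroup.mem_addSubgroupOf, AddMonoidHom.mem_range]
  constructor
  · rintro ⟨p, hp, hpx⟩
    exact ⟨⟨p, hp⟩, Subtype.ext hpx⟩
  · rintro ⟨p, rfl⟩
    exact ⟨p.1, p.2, rfl⟩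

/-- This is the second isomorphism theorem, K/(H ∩ K) ≅ (H + K)/H. -/
theorem relIndex_of_sup {H K N : AddSubgroup (Fin n → ℚ)} (h : H ⊔ K = N) :
    (H ⊓ K).relIndex K = H.relIndex N := by
  rw [AddSubgroup.inf_relIndex_right, ← h, sup_comm, AddSubgroup.relIndex_sup_right]

/-- Since ℤⁿ[M] = ℤⁿ + M ℤⁿ[M] and ℤⁿ lies in ℤⁿ[M⁻¹], the intersection ℤⁿ[M] ∩ ℤⁿ[M⁻¹] meets every
residue class modulo M ℤⁿ[M]. -/
theorem relIndex_inf_polyLattice (M : Matrix (Fin n) (Fin n) ℚ) :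
    ((polyLattice M).map (act M) ⊓ polyLattice M⁻¹).relIndex
      (polyLattice M ⊓ polyLattice M⁻¹) = residueCard M := by
  have h1 := act_map_polyLattice_le M
  rw [← relIndex_map_polyLattice, ← relIndex_of_sup (H := (polyLattice M).map (act M))
    (K := polyLattice M ⊓ polyLattice M⁻¹)]
  · rw [← inf_assoc, inf_eq_left.2 h1]
  · refine le_antisymm (sup_le h1 inf_le_left) ((polyLattice_le_sup M).trans ?_)
    rw [sup_comm]
    exact sup_le_sup_left (le_inf (intLattice_le_polyLattice _) (intLattice_le_polyLattice _)) _

theorem map_act_map_inv {M : Matrix (Fin n) (Fin n) ℚ} (hM : IsUnit M.det)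
    (H : AddSubgroup (Fin n → ℚ)) : (H.map (act M⁻¹)).map (act M) = H := by
  rw [← map_act_mul, Matrix.mul_nonsing_inv _ hM, map_act_one]

/-- This is `relIndex_inf_polyLattice` for `M⁻¹`, transported by `M`. It involves the same subgroup
M ℤⁿ[M] ∩ ℤⁿ[M⁻¹]. -/
theorem relIndex_inf_map_polyLattice {M : Matrix (Fin n) (Fin n) ℚ} (hM : IsUnit M.det) :
    ((polyLattice M).map (act M) ⊓ polyLattice M⁻¹).relIndex
      ((polyLattice M ⊓ polyLattice M⁻¹).map (act M)) = residueCard M⁻¹ := by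
  have h := relIndex_inf_polyLattice M⁻¹
  rw [Matrix.nonsing_inv_nonsing_inv _ hM,
    ← AddSubgroup.relIndex_map_map_of_injective _ _ (act_injective hM),
    AddSubgroup.map_inf _ _ _ (act_injective hM), map_act_map_inv hM, inf_comm,
    inf_comm (polyLattice M⁻¹) (polyLattice M)] at h
  exact h

/-- S = ℤⁿ[M] ∩ ℤⁿ[M⁻¹] is a lattice, and T = M ℤⁿ[M] ∩ ℤⁿ[M⁻¹] has index a in S and b in MS. As MS
has |det M| times the covolume of S, a = |det M| b. Covolumes are replaced by indices in a common
overlattice G, computed through S and through MS. -/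
theorem residueCard_eq {M : Matrix (Fin n) (Fin n) ℚ} (hM : IsUnit M.det) :
    (residueCard M : ℚ) = |M.det| * residueCard M⁻¹ := by
  set S := polyLattice M ⊓ polyLattice M⁻¹ with hS
  set T := (polyLattice M).map (act M) ⊓ polyLattice M⁻¹ with hT
  have hTS : T ≤ S := inf_le_inf_right _ (act_map_polyLattice_le M)
  have hTMS : T ≤ S.map (act M) := by
    rw [hS, AddSubgroup.map_inf _ _ _ (act_injective hM)]
    refine inf_le_inf_left _ ?_
    have := AddSubgroup.map_mono (f := act M) (act_map_polyLattice_le M⁻¹)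
    rwa [map_act_map_inv hM] at this
  obtain ⟨m, hm, hmS⟩ := exists_nsmul_inf_polyLattice hM
  obtain ⟨m', hm', hmM⟩ := exists_int_matrix M
  -- Multiplication by 1/m. Then E = (1/m)ℤⁿ contains S, and G = (1/(m'm))ℤⁿ contains both E and ME
  -- because m'M is integral.
  let Q : ℕ → Matrix (Fin n) (Fin n) ℚ := fun m => (m : ℚ)⁻¹ • 1
  have hQ : ∀ {m : ℕ}, m ≠ 0 → ∀ {v : Fin n → ℚ}, m • v ∈ intLattice n →
      v ∈ (intLattice n).map (act (Q m)) := by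
    intro m hm v hv
    refine ⟨_, hv, ?_⟩
    have : (m : ℚ) ≠ 0 := by exact_mod_cast hm
    change (((m : ℚ)⁻¹ • (1 : Matrix (Fin n) (Fin n) ℚ))).mulVec (m • v) = v
    rw [Matrix.smul_mulVec, Matrix.one_mulVec, ← Nat.cast_smul_eq_nsmul ℚ, smul_smul,
      inv_mul_cancel₀ this, one_smul]
  have hQdet : ∀ {m : ℕ}, m ≠ 0 → IsUnit (Q m).det := by
    intro m hm
    have : (m : ℚ) ≠ 0 := by exact_mod_cast hm
    simp [Q, this]
  set L := intLattice n
  set E := L.map (act (Q m)) with hE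
  set G := L.map (act (Q (m' * m))) with hG
  have hEm : ∀ v ∈ E, m • v ∈ L := by
    rintro _ ⟨u, hu, rfl⟩
    have : (m : ℚ) ≠ 0 := by exact_mod_cast hm
    change m • (((m : ℚ)⁻¹ • (1 : Matrix (Fin n) (Fin n) ℚ))).mulVec u ∈ L
    rw [Matrix.smul_mulVec, Matrix.one_mulVec, ← Nat.cast_smul_eq_nsmul ℚ, smul_smul,
      mul_inv_cancel₀ this, one_smul]
    exact hu
  have hSE : S ≤ E := fun v hv => hQ hm (hmS v hv)
  have hLS : L ≤ S := le_inf (intLattice_le_polyLattice _) (intLattice_le_polyLattice _)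
  have hEG : E ≤ G := fun v hv => hQ (mul_ne_zero hm' hm) (by
    rw [mul_smul]; exact nsmul_mem (hEm v hv) _)
  have hMEG : E.map (act M) ≤ G := by
    rintro _ ⟨v, hv, rfl⟩
    refine hQ (mul_ne_zero hm' hm) ?_
    rw [mul_smul, ← map_nsmul]
    exact hmM _ (hEm v hv)
  -- The index of S in E is finite because ℤⁿ ⊆ S ⊆ E; it is later cancelled from both counts.
  have hSE0 : S.relIndex E ≠ 0 := by
    have h : (L.relIndex E : ℚ) ≠ 0 := by
      have := relIndex_map_intLattice (n := n) (M := 1) (N := Q m) (by simp) (hQdet hm)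
        (by rw [map_act_one]; exact hLS.trans hSE)
      rw [map_act_one] at this
      rw [this]
      exact div_ne_zero (by simp) (abs_ne_zero.2 (hQdet hm).ne_zero)
    intro h0
    rw [← AddSubgroup.relIndex_mul_relIndex L S E hLS hSE, h0, mul_zero, Nat.cast_zero] at h
    exact h rfl
  have e1 : T.relIndex G = residueCard M * S.relIndex E * E.relIndex G := by
    rw [← relIndex_inf_polyLattice, AddSubgroup.relIndex_mul_relIndex _ _ _ hTS hSE,
      AddSubgroup.relIndex_mul_relIndex _ _ _ (hTS.trans hSE) hEG]
  have e2 : T.relIndex G = residueCard M⁻¹ * S.relIndex E * (E.map (act M)).relIndex G := by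
    have hMS := AddSubgroup.map_mono (f := act M) hSE
    rw [← relIndex_inf_map_polyLattice hM,
      ← AddSubgroup.relIndex_map_map_of_injective S E (act_injective hM),
      AddSubgroup.relIndex_mul_relIndex _ _ _ hTMS hMS,
      AddSubgroup.relIndex_mul_relIndex _ _ _ (hTMS.trans hMS) hMEG]
  have hG0 := (hQdet (mul_ne_zero hm' hm)).ne_zero
  have hm0 := (hQdet hm).ne_zero
  have d1 := relIndex_map_intLattice (hQdet hm) (hQdet (mul_ne_zero hm' hm)) hEG
  have hMQ : E.map (act M) = L.map (act (M * Q m)) := (map_act_mul _ _ _).symm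
  have d2 := relIndex_map_intLattice (M := M * Q m)
    (by rw [Matrix.det_mul]; exact hM.mul (hQdet hm)) (hQdet (mul_ne_zero hm' hm))
    (by rw [← hMQ]; exact hMEG)
  rw [← hMQ, Matrix.det_mul, abs_mul] at d2
  have e := congrArg (Nat.cast : ℕ → ℚ) (e1.symm.trans e2)
  push_cast at e
  rw [d1, d2] at e
  have hs : (S.relIndex E : ℚ) ≠ 0 := by exact_mod_cast hSE0
  have a1 := abs_ne_zero.2 hG0
  have a2 := abs_ne_zero.2 hm0
  field_simp at e
  linarith

end Lattice

/-! ### Scaling of the B-adic norm and measure -/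

section Badic

variable {n : ℕ} {A : Matrix (Fin n) (Fin n) ℚ} (hA : IsExpanding A)

theorem act_inv_map_laurentLattice_le {M : Matrix (Fin n) (Fin n) ℚ} (hM : IsUnit M.det) :
    (laurentLattice M).map (act M⁻¹) ≤ laurentLattice M := by
  unfold laurentLattice
  rw [AddSubgroup.map_iSup]
  refine iSup_le fun k => ?_
  have h : M⁻¹ * M ^ k = M ^ (-1 + k) := by
    rw [Matrix.zpow_add hM, Matrix.zpow_neg_one]
  rw [AddSubgroup.map_map, ← act_mul, h]
  exact le_iSup (fun k : ℤ => (intLattice n).map (act (M ^ k))) (-1 + k)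

/-- Multiplication by `A⁻¹` on `ℤⁿ(A)`. -/
def divLaurent : Laurent hA →+ Laurent hA :=
  ((act A⁻¹).comp (laurentLattice A).subtype).codRestrict (laurentLattice A)
    fun x => act_inv_map_laurentLattice_le hA.isUnit_det ⟨x, x.2, rfl⟩

theorem vec_injective : Function.Injective (Laurent.vec hA) := Subtype.val_injective

theorem vec_mulLaurent (y : Laurent hA) :
    Laurent.vec hA (mulLaurent hA y) = act A (Laurent.vec hA y) := rfl

theorem vec_divLaurent (y : Laurent hA) :
    Laurent.vec hA (divLaurent hA y) = act A⁻¹ (Laurent.vec hA y) := rfl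

theorem mulLaurent_divLaurent (y : Laurent hA) : mulLaurent hA (divLaurent hA y) = y := by
  apply vec_injective
  rw [vec_mulLaurent, vec_divLaurent, act_act, Matrix.mul_nonsing_inv _ hA.isUnit_det, act_one]
  rfl

theorem divLaurent_mulLaurent (y : Laurent hA) : divLaurent hA (mulLaurent hA y) = y := by
  apply vec_injective
  rw [vec_divLaurent, vec_mulLaurent, act_act, Matrix.nonsing_inv_mul _ hA.isUnit_det, act_one]
  rfl

theorem vec_divLaurent_mem {y : Laurent hA} {k : ℤ} (h : Laurent.vec hA y ∈ filt A⁻¹ k) :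
    Laurent.vec hA (divLaurent hA y) ∈ filt A⁻¹ (k + 1) := by
  have := map_filt (isUnit_det_inv hA) 1 k
  rw [zpow_one, add_comm] at this
  rw [← this]
  exact ⟨_, h, rfl⟩

theorem norm_eq_zero_of_mem_filt {y : Laurent hA} (h : ∀ k, Laurent.vec hA y ∈ filt A⁻¹ k) :
    ‖y‖ = 0 := by
  rw [norm_eq_badicAbs, badicAbs, nu_eq_top hA h]
  rfl

theorem norm_divLaurent_le (y : Laurent hA) :
    ‖divLaurent hA y‖ ≤ (residueCard A⁻¹ : ℝ)⁻¹ * ‖y‖ := by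
  have hb : (0 : ℝ) < residueCard A⁻¹ := lt_of_lt_of_le one_pos (one_le_b hA)
  rcases nu_cases hA y with hy | ⟨j, hj, hj'⟩
  · rw [norm_eq_zero_of_mem_filt hA fun k => by simpa using vec_divLaurent_mem hA (hy (k - 1))]
    positivity
  · refine (badicAbs_le hA (vec_divLaurent_mem hA hj)).trans ?_
    rw [neg_add_rev, zpow_add₀ hb.ne', zpow_neg_one]
    exact mul_le_mul_of_nonneg_left (le_badicAbs hA hj') (by positivity)

theorem continuous_divLaurent : Continuous (divLaurent hA) :=
  AddMonoidHomClass.continuous_of_bound _ _ (norm_divLaurent_le hA)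

theorem norm_eq_zero_of_residueCard_eq_one (hb : residueCard A⁻¹ = 1) (y : Laurent hA) :
    ‖y‖ = 0 := by
  refine norm_eq_zero_of_mem_filt hA ?_
  rcases nu_cases hA y with hy | ⟨j, hj, hj'⟩
  · exact hy
  · exact absurd (filt_le_succ hA hb j hj) hj'

theorem mulBadic_coe (y : Laurent hA) : mulBadic hA y = (mulLaurent hA y : BadicSeries hA) :=
  AddMonoidHom.completion_coe _ (continuous_mulLaurent hA) y

/-- Multiplication by `A⁻¹` on `ℤⁿ((B))`. -/
def divBadic : BadicSeries hA →+ BadicSeries hA :=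
  (divLaurent hA).completion (continuous_divLaurent hA)

theorem divBadic_coe (y : Laurent hA) : divBadic hA y = (divLaurent hA y : BadicSeries hA) :=
  AddMonoidHom.completion_coe _ (continuous_divLaurent hA) y

theorem continuous_mulBadic : Continuous (mulBadic hA) :=
  AddMonoidHom.continuous_completion _ (continuous_mulLaurent hA)

theorem continuous_divBadic : Continuous (divBadic hA) :=
  AddMonoidHom.continuous_completion _ (continuous_divLaurent hA)

theorem mulBadic_divBadic (y : BadicSeries hA) : mulBadic hA (divBadic hA y) = y := by
  induction y using UniformSpace.Completion.induction_on with
  | hp => exact isClosed_eq ((continuous_mulBadic hA).comp (continuous_divBadic hA)) continuous_id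
  | ih y => rw [divBadic_coe, mulBadic_coe, mulLaurent_divLaurent]

theorem divBadic_mulBadic (y : BadicSeries hA) : divBadic hA (mulBadic hA y) = y := by
  induction y using UniformSpace.Completion.induction_on with
  | hp => exact isClosed_eq ((continuous_divBadic hA).comp (continuous_mulBadic hA)) continuous_id
  | ih y => rw [mulBadic_coe, divBadic_coe, divLaurent_mulLaurent]

theorem norm_divBadic_le (y : BadicSeries hA) :
    ‖divBadic hA y‖ ≤ (residueCard A⁻¹ : ℝ)⁻¹ * ‖y‖ := by
  induction y using UniformSpace.Completion.induction_on with
  | hp => exact isClosed_le (continuous_divBadic hA).norm (continuous_norm.const_mul _)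
  | ih y =>
    rw [divBadic_coe, UniformSpace.Completion.norm_coe, UniformSpace.Completion.norm_coe]
    exact norm_divLaurent_le hA y

/-- The factor 1/b is at most 1/2 unless b = 1, and in that case the whole B-adic factor has norm
zero. -/
theorem norm_divBadic_le_half (y : BadicSeries hA) : ‖divBadic hA y‖ ≤ 1 / 2 * ‖y‖ := by
  by_cases hb : residueCard A⁻¹ = 1
  · have h0 : ∀ y : BadicSeries hA, ‖y‖ = 0 := fun y => by
      induction y using UniformSpace.Completion.induction_on with
      | hp => exact isClosed_eq continuous_norm continuous_const
      | ih y =>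
        rw [UniformSpace.Completion.norm_coe]
        exact norm_eq_zero_of_residueCard_eq_one hA hb y
    rw [h0, h0, mul_zero]
  · refine (norm_divBadic_le hA y).trans (mul_le_mul_of_nonneg_right ?_ (norm_nonneg _))
    have := residueCard_pos (isUnit_det_inv hA)
    have h2 : (2 : ℝ) ≤ residueCard A⁻¹ := by exact_mod_cast (by lia : 2 ≤ residueCard A⁻¹)
    rw [one_div]
    exact inv_anti₀ two_pos h2

theorem norm_divBadic_iterate_le (k : ℕ) (y : BadicSeries hA) :
    ‖(divBadic hA)^[k] y‖ ≤ (1 / 2) ^ k * ‖y‖ := by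
  induction k with
  | zero => simp
  | succ k ih =>
    rw [Function.iterate_succ_apply', pow_succ', mul_assoc]
    exact (norm_divBadic_le_half hA _).trans (by linarith)

theorem norm_add_le_max_badic (x y : BadicSeries hA) : ‖x + y‖ ≤ max ‖x‖ ‖y‖ := by
  induction x, y using UniformSpace.Completion.induction_on₂ with
  | hp => exact isClosed_le (by fun_prop) (by fun_prop)
  | ih x y =>
    rw [← UniformSpace.Completion.coe_add]
    simp only [UniformSpace.Completion.norm_coe]
    exact badicAbs_add_le_max hA x y

instance : LocallyCompactSpace (BadicSeries hA) :=
  (isCompact_unitBall hA).locallyCompactSpace_of_mem_nhds_of_addGroup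
    (Metric.closedBall_mem_nhds 0 one_pos)

instance : Countable (Laurent hA) := inferInstanceAs (Countable (laurentLattice A))

/-- Together with local compactness this makes the B-adic Haar measure σ-finite, as product measures
require. -/
instance : SecondCountableTopology (BadicSeries hA) :=
  UniformSpace.secondCountable_of_separable _

theorem norm_coe_le_one_iff {y : Laurent hA} :
    ‖(y : BadicSeries hA)‖ ≤ 1 ↔ Laurent.vec hA y ∈ filt A⁻¹ 0 := by
  rw [UniformSpace.Completion.norm_coe]
  refine ⟨fun h => mem_filt_zero_of_norm_lt hA (by linarith), fun h => ?_⟩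
  have := badicAbs_le hA h
  rwa [neg_zero, zpow_zero] at this

theorem norm_sub_le_one {x y : BadicSeries hA} (hx : ‖x‖ ≤ 1) (hy : ‖y‖ ≤ 1) : ‖x - y‖ ≤ 1 := by
  rw [sub_eq_add_neg]
  exact (norm_add_le_max_badic hA x (-y)).trans (max_le hx (by rwa [norm_neg]))

theorem norm_divBadic_coe_le_one_iff {y : Laurent hA} :
    ‖divBadic hA y‖ ≤ 1 ↔ Laurent.vec hA y ∈ filt A⁻¹ (-1) := by
  rw [divBadic_coe, norm_coe_le_one_iff]
  constructor
  · intro h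
    have := vec_mulLaurent_mem hA h
    rwa [mulLaurent_divLaurent, zero_sub] at this
  · intro h
    have := vec_divLaurent_mem hA h
    rwa [neg_add_cancel] at this

theorem norm_divBadic_le_one {y : BadicSeries hA} (hy : ‖y‖ ≤ 1) : ‖divBadic hA y‖ ≤ 1 := by
  have := norm_divBadic_le_half hA y
  linarith [norm_nonneg y]

theorem badicMeasure_unitBall : badicMeasure hA (Metric.closedBall 0 1) = 1 :=
  Measure.addHaarMeasure_self (K₀ := badicIntegers hA)

instance : (badicMeasure hA).IsAddHaarMeasure :=
  inferInstanceAs (Measure.addHaarMeasure (badicIntegers hA)).IsAddHaarMeasure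

theorem filt_neg_one_le_laurentLattice {A : Matrix (Fin n) (Fin n) ℚ} (hA : IsExpanding A) :
    filt A⁻¹ (-1) ≤ laurentLattice A := by
  unfold filt
  rw [Matrix.inv_zpow' hA.isUnit_det, neg_neg, zpow_one]
  refine (AddSubgroup.map_mono (iSup_le fun k => ?_)).trans
    (act_map_laurentLattice_le hA.isUnit_det)
  have h := le_iSup (fun k : ℤ => (intLattice n).map (act (A ^ k))) (-(k : ℤ))
  rwa [← Matrix.inv_zpow' hA.isUnit_det, zpow_natCast] at h

/-- The image of the unit ball is a disjoint union of b translates of it, one for each coset of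
ℤⁿ[B] in B⁻¹ℤⁿ[B]. -/
theorem badicMeasure_image_unitBall :
    badicMeasure hA (mulBadic hA '' Metric.closedBall 0 1) = residueCard A⁻¹ := by
  let G : ℤ → AddSubgroup (Laurent hA) := fun k => (filt A⁻¹ k).comap (Laurent.vec hA)
  let Q := G (-1) ⧸ (G 0).addSubgroupOf (G (-1))
  have hQ : Nat.card Q = residueCard A⁻¹ := by
    rw [← AddSubgroup.index_eq_card]
    change (G 0).relIndex (G (-1)) = _
    have hrel := relIndex_succ hA (-1)
    rw [neg_add_cancel] at hrel
    rw [← hrel]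
    change ((filt A⁻¹ 0).comap (Laurent.vec hA)).relIndex (G (-1)) = _
    rw [AddSubgroup.relIndex_comap, AddSubgroup.map_comap_eq_self]
    rw [show (Laurent.vec hA).range = laurentLattice A from AddSubgroup.range_subtype _]
    exact filt_neg_one_le_laurentLattice hA
  have : Finite Q := Nat.finite_of_card_ne_zero (by
    rw [hQ]; exact (residueCard_pos (isUnit_det_inv hA)).ne')
  have : Fintype Q := Fintype.ofFinite Q
  let rep : Q → Laurent hA := fun q => (q.out : G (-1))
  have hrep : ∀ q, Laurent.vec hA (rep q) ∈ filt A⁻¹ (-1) := fun q => q.out.2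
  have hunion : mulBadic hA '' Metric.closedBall 0 1 =
      ⋃ q : Q, (fun y => (rep q : BadicSeries hA) + y) '' Metric.closedBall 0 1 := by
    ext y
    simp only [Set.mem_image, Set.mem_iUnion, mem_closedBall_zero_iff]
    constructor
    · rintro ⟨z, hz, rfl⟩
      -- Density gives an element of ℤⁿ(A) within distance 1; by the ultrametric inequality it lies
      -- in B⁻¹ℤⁿ[B], and its class names the translate.
      obtain ⟨x, hx⟩ := (UniformSpace.Completion.denseRange_coe (α := Laurent hA)).exists_dist_lt
        (mulBadic hA z) one_pos
      rw [dist_eq_norm] at hx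
      have hx1 : Laurent.vec hA x ∈ filt A⁻¹ (-1) := by
        rw [← norm_divBadic_coe_le_one_iff, show (x : BadicSeries hA) =
          mulBadic hA z - (mulBadic hA z - x) by abel, map_sub, divBadic_mulBadic]
        exact norm_sub_le_one hA hz (norm_divBadic_le_one hA hx.le)
      let q : Q := QuotientAddGroup.mk ⟨x, hx1⟩
      have hq' := QuotientAddGroup.eq.1 (Quotient.out_eq
        (QuotientAddGroup.mk ⟨x, hx1⟩ : G (-1) ⧸ (G 0).addSubgroupOf (G (-1))))
      have hq : Laurent.vec hA (-rep q + x) ∈ filt A⁻¹ 0 := hq'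
      refine ⟨q, mulBadic hA z - rep q, ?_, by abel⟩
      have h2 := (norm_coe_le_one_iff hA).2 hq
      rw [UniformSpace.Completion.coe_add, UniformSpace.Completion.coe_neg, neg_add_eq_sub,
        norm_sub_rev] at h2
      rw [show mulBadic hA z - rep q = (mulBadic hA z - x) - (rep q - x) by abel]
      exact norm_sub_le_one hA hx.le h2
    · rintro ⟨q, z, hz, rfl⟩
      refine ⟨divBadic hA (rep q + z), ?_, mulBadic_divBadic hA _⟩
      rw [map_add]
      exact (norm_add_le_max_badic hA _ _).trans
        (max_le ((norm_divBadic_coe_le_one_iff hA).2 (hrep q)) (norm_divBadic_le_one hA hz))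
  rw [hunion, measure_iUnion]
  · simp only [Set.image_add_left, measure_preimage_add, badicMeasure_unitBall]
    rw [tsum_fintype, Finset.sum_const, Finset.card_univ, ← Nat.card_eq_fintype_card, hQ]
    simp
  · intro q q' hqq'
    rw [Function.onFun, Set.disjoint_left]
    rintro _ ⟨z, hz, rfl⟩ ⟨z', hz', h⟩
    apply hqq'
    rw [mem_closedBall_zero_iff] at hz hz'
    rw [← Quotient.out_eq q, ← Quotient.out_eq q']
    refine QuotientAddGroup.eq.2 ?_
    change Laurent.vec hA (-rep q + rep q') ∈ filt A⁻¹ 0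
    rw [← norm_coe_le_one_iff, UniformSpace.Completion.coe_add, UniformSpace.Completion.coe_neg]
    rw [show -(rep q : BadicSeries hA) + rep q' = z - z' by
      rw [neg_add_eq_sub, sub_eq_sub_iff_add_eq_add, add_comm z]; exact h]
    exact norm_sub_le_one hA hz hz'
  · intro q
    rw [Set.image_add_left]
    exact (continuous_const_add _).measurable Metric.isClosed_closedBall.measurableSet

end Badic

/-! ### Contraction of `A⁻¹` on Euclidean space -/

section Euclidean

open Filter Topology

variable {n : ℕ} {A : Matrix (Fin n) (Fin n) ℚ}

attribute [local instance] Matrix.linftyOpNormedRing Matrix.linftyOpNormedAlgebra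

/-- By Gelfand's formula, ‖x^k‖ ≤ θ^k eventually for any θ strictly between the spectral radius and
1; the constant absorbs the finitely many remaining k. -/
theorem exists_norm_pow_le {R : Type*} [NormedRing R] [NormedAlgebra ℂ R] [CompleteSpace R]
    (x : R) (hx : ∀ z ∈ spectrum ℂ x, ‖z‖ < 1) :
    ∃ C θ : ℝ, 0 ≤ C ∧ 0 ≤ θ ∧ θ < 1 ∧ ∀ k : ℕ, ‖x ^ k‖ ≤ C * θ ^ k := by
  rcases subsingleton_or_nontrivial R with hR | hR
  · exact ⟨0, 0, le_rfl, le_rfl, one_pos, fun k => by rw [Subsingleton.elim (x ^ k) 0]; simp⟩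
  have hρ : spectralRadius ℂ x < 1 :=
    spectrum.spectralRadius_lt_of_forall_lt x (r := 1) fun z hz => hx z hz
  obtain ⟨θ, hθ, hθ1⟩ := ENNReal.lt_iff_exists_nnreal_btwn.1 hρ
  have hθ0 : 0 < θ := by exact_mod_cast (zero_le).trans_lt hθ
  have hev : ∀ᶠ k : ℕ in atTop, ‖x ^ k‖ / (θ : ℝ) ^ k ≤ 1 := by
    filter_upwards
      [(spectrum.pow_nnnorm_pow_one_div_tendsto_nhds_spectralRadius x).eventually_lt_const hθ,
      eventually_ge_atTop 1] with k hk hk1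
    rw [div_le_one (by positivity)]
    have h := ENNReal.rpow_le_rpow hk.le (z := k) (by positivity)
    rw [← ENNReal.rpow_mul, one_div_mul_cancel (by positivity), ENNReal.rpow_one,
      ENNReal.rpow_natCast] at h
    exact_mod_cast h
  obtain ⟨C, hC⟩ := (Filter.isBoundedUnder_of_eventually_le hev).bddAbove_range
  refine ⟨max C 0, θ, le_max_right _ _, θ.2, by exact_mod_cast hθ1, fun k => ?_⟩
  rw [← div_le_iff₀ (by positivity)]
  exact (hC ⟨k, rfl⟩).trans (le_max_left _ _)

theorem IsExpanding.exists_norm_inv_pow_le (hA : IsExpanding A) :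
    ∃ C θ : ℝ, 0 ≤ C ∧ 0 ≤ θ ∧ θ < 1 ∧
      ∀ k : ℕ, ‖(A⁻¹.map (algebraMap ℚ ℂ)) ^ k‖ ≤ C * θ ^ k := by
  have : CompleteSpace (Matrix (Fin n) (Fin n) ℂ) := FiniteDimensional.complete ℂ _
  refine exists_norm_pow_le _ fun z hz => ?_
  let u : (Matrix (Fin n) (Fin n) ℂ)ˣ :=
    Units.map (algebraMap ℚ ℂ).mapMatrix.toMonoidHom (Matrix.nonsingInvUnit A hA.isUnit_det)
  have hz' : z ∈ spectrum ℂ (↑u⁻¹ : Matrix (Fin n) (Fin n) ℂ) := hz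
  rw [← spectrum.map_inv, Set.mem_inv] at hz'
  have h := hA _ hz'
  rw [norm_inv] at h
  by_contra hlt
  exact absurd (inv_le_one_of_one_le₀ (not_lt.1 hlt)) (not_le.2 h)

/-- The action of a rational matrix on Euclidean space. -/
def euclAct (M : Matrix (Fin n) (Fin n) ℚ) :
    EuclideanSpace ℝ (Fin n) →ₗ[ℝ] EuclideanSpace ℝ (Fin n) :=
  Matrix.toEuclideanLin (M.map (Rat.cast : ℚ → ℝ))

theorem euclAct_apply (M : Matrix (Fin n) (Fin n) ℚ) (x : EuclideanSpace ℝ (Fin n)) :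
    euclAct M x = WithLp.toLp 2 ((M.map (Rat.cast : ℚ → ℝ)).mulVec x.ofLp) := rfl

theorem euclAct_mul (M N : Matrix (Fin n) (Fin n) ℚ) (x : EuclideanSpace ℝ (Fin n)) :
    euclAct (M * N) x = euclAct M (euclAct N x) := by
  rw [euclAct_apply, euclAct_apply, euclAct_apply, Matrix.mulVec_mulVec]
  congr 2
  exact Matrix.map_mul (f := Rat.castHom ℝ)

theorem euclAct_one (x : EuclideanSpace ℝ (Fin n)) : euclAct 1 x = x := by
  have : (1 : Matrix (Fin n) (Fin n) ℚ).map (Rat.cast : ℚ → ℝ) = 1 :=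
    Matrix.map_one _ Rat.cast_zero Rat.cast_one
  rw [euclAct_apply, this, Matrix.one_mulVec]

theorem euclAct_pow (M : Matrix (Fin n) (Fin n) ℚ) (k : ℕ) (x : EuclideanSpace ℝ (Fin n)) :
    euclAct (M ^ k) x = (euclAct M)^[k] x := by
  induction k with
  | zero => rw [pow_zero, euclAct_one]; rfl
  | succ k ih => rw [pow_succ', euclAct_mul, ih, Function.iterate_succ_apply']

theorem det_euclAct (M : Matrix (Fin n) (Fin n) ℚ) :
    LinearMap.det (euclAct M) = ((M.det : ℚ) : ℝ) := by
  unfold euclAct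
  rw [Matrix.toEuclideanLin, Matrix.toLpLin_eq_toLin, LinearMap.det_toLin]
  exact ((Rat.castHom ℝ).map_det M).symm

/-- The inclusion of ℝⁿ into ℂⁿ is isometric for sup norms, so the bounds obtained from the complex
spectrum apply to real vectors. -/
theorem norm_mulVec_map_le (M : Matrix (Fin n) (Fin n) ℚ) (v : Fin n → ℝ) :
    ‖(M.map (Rat.cast : ℚ → ℝ)).mulVec v‖ ≤ ‖M.map (algebraMap ℚ ℂ)‖ * ‖v‖ := by
  have hn : ∀ w : Fin n → ℝ, ‖fun i => ((w i : ℝ) : ℂ)‖ = ‖w‖ := fun w => by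
    simp [Pi.norm_def]
  have h := Matrix.linfty_opNorm_mulVec (M.map (algebraMap ℚ ℂ)) fun i => ((v i : ℝ) : ℂ)
  have e : (M.map (algebraMap ℚ ℂ)).mulVec (fun i => ((v i : ℝ) : ℂ)) =
      fun i => (((M.map (Rat.cast : ℚ → ℝ)).mulVec v i : ℝ) : ℂ) := by
    ext i
    simp [Matrix.mulVec, dotProduct]
  rwa [e, hn, hn] at h

theorem IsExpanding.exists_norm_euclAct_le (hA : IsExpanding A) :
    ∃ C θ : ℝ, 0 ≤ C ∧ 0 ≤ θ ∧ θ < 1 ∧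
      ∀ (k : ℕ) (x : EuclideanSpace ℝ (Fin n)), ‖(euclAct A⁻¹)^[k] x‖ ≤ C * θ ^ k * ‖x‖ := by
  obtain ⟨C, θ, hC, h0, h1, h⟩ := hA.exists_norm_inv_pow_le
  let e := EuclideanSpace.equiv (Fin n) ℝ
  -- The two extra factors compare the sup norm with the Euclidean norm; the rate θ is unaffected.
  refine ⟨‖(e.symm : (Fin n → ℝ) →L[ℝ] EuclideanSpace ℝ (Fin n))‖ * C *
    ‖(e : EuclideanSpace ℝ (Fin n) →L[ℝ] (Fin n → ℝ))‖, θ, by positivity, h0, h1, fun k x => ?_⟩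
  rw [← euclAct_pow]
  have h2 := (e.symm : (Fin n → ℝ) →L[ℝ] EuclideanSpace ℝ (Fin n)).le_opNorm
    (((A⁻¹ ^ k).map (Rat.cast : ℚ → ℝ)).mulVec x.ofLp)
  have h3 := norm_mulVec_map_le (A⁻¹ ^ k) x.ofLp
  have h4 := (e : EuclideanSpace ℝ (Fin n) →L[ℝ] (Fin n → ℝ)).le_opNorm x
  have h5 : ‖(A⁻¹ ^ k).map (algebraMap ℚ ℂ)‖ ≤ C * θ ^ k := by
    have : (A⁻¹ ^ k).map (algebraMap ℚ ℂ) = (A⁻¹.map (algebraMap ℚ ℂ)) ^ k :=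
      map_pow (algebraMap ℚ ℂ).mapMatrix A⁻¹ k
    rw [this]
    exact h k
  change ‖euclAct (A⁻¹ ^ k) x‖ ≤ _ at h2
  change ‖x.ofLp‖ ≤ _ at h4
  refine h2.trans ((mul_le_mul_of_nonneg_left (h3.trans (mul_le_mul h5 h4 (norm_nonneg _)
    (by positivity))) (norm_nonneg _)).trans (le_of_eq (by ring)))

end Euclidean

/-! ### Haar scaling and discreteness in the representation space -/

section RepSpace

variable {n : ℕ} {A : Matrix (Fin n) (Fin n) ℚ} (hA : IsExpanding A)

/-- Multiplication by `A` on the representation space, as an automorphism. -/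
def repEquiv : RepSpace hA ≃ₜ+ RepSpace hA where
  toFun := mulRep hA
  invFun p := (euclAct A⁻¹ p.1, divBadic hA p.2)
  left_inv p := by
    refine Prod.ext ?_ (divBadic_mulBadic hA p.2)
    change euclAct A⁻¹ (euclAct A p.1) = p.1
    rw [← euclAct_mul, Matrix.nonsing_inv_mul _ hA.isUnit_det, euclAct_one]
  right_inv p := by
    refine Prod.ext ?_ (mulBadic_divBadic hA p.2)
    change euclAct A (euclAct A⁻¹ p.1) = p.1
    rw [← euclAct_mul, Matrix.mul_nonsing_inv _ hA.isUnit_det, euclAct_one]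
  map_add' p q := Prod.ext (map_add (euclAct A) p.1 q.1) (map_add (mulBadic hA) p.2 q.2)
  continuous_toFun := (euclAct A).continuous_of_finiteDimensional.prodMap (continuous_mulBadic hA)
  continuous_invFun :=
    (euclAct A⁻¹).continuous_of_finiteDimensional.prodMap (continuous_divBadic hA)

theorem isContracting_repEquiv_symm : IsContracting (repEquiv hA).toAddEquiv.symm := by
  obtain ⟨C, θ, hC, h0, h1, h⟩ := hA.exists_norm_euclAct_le
  refine ⟨max C 1, max θ (1 / 2), by positivity, by positivity, max_lt h1 (by norm_num),
    fun k p => ?_⟩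
  have e : (repEquiv hA).toAddEquiv.symm^[k] p =
      ((euclAct A⁻¹)^[k] p.1, (divBadic hA)^[k] p.2) := by
    change (Prod.map (euclAct A⁻¹) (divBadic hA))^[k] p = _
    rw [Prod.map_iterate]
    rfl
  rw [e]
  refine max_le ((h k p.1).trans ?_) ((norm_divBadic_iterate_le hA k p.2).trans ?_)
  · exact mul_le_mul (mul_le_mul (le_max_left _ _) (pow_le_pow_left₀ h0 (le_max_left _ _) k)
      (by positivity) (by positivity)) (le_max_left _ _) (norm_nonneg _) (by positivity)
  · refine mul_le_mul ?_ (le_max_right _ _) (norm_nonneg _) (by positivity)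
    rw [← one_mul ((1 / 2 : ℝ) ^ k)]
    exact mul_le_mul (le_max_right _ _) (pow_le_pow_left₀ (by norm_num) (le_max_right _ _) k)
      (by positivity) (by positivity)

instance : (repMeasure hA).IsAddHaarMeasure :=
  inferInstanceAs ((volume : Measure (EuclideanSpace ℝ (Fin n))).prod
    (badicMeasure hA)).IsAddHaarMeasure

/-- A topological automorphism scales Haar measure by one constant on all sets. It is read off from
a product of unit balls as |det A| b, which is a. -/
theorem repMeasure_image (s : Set (RepSpace hA)) :
    repMeasure hA (mulRep hA '' s) = residueCard A * repMeasure hA s := by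
  set c := addEquivAddHaarChar (repEquiv hA)
  have hc : ∀ s, repMeasure hA (mulRep hA '' s) = c * repMeasure hA s := by
    intro s
    have h := addEquivAddHaarChar_smul_preimage (repMeasure hA) (X := repEquiv hA '' s)
      (repEquiv hA)
    rw [Set.preimage_image_eq _ (repEquiv hA).injective] at h
    exact h.symm
  suffices hca : (c : ENNReal) = residueCard A by rw [hc, hca]
  have hprod := hc (Metric.ball 0 1 ×ˢ Metric.closedBall 0 1)
  have himg : mulRep hA '' (Metric.ball 0 1 ×ˢ Metric.closedBall 0 1) =
      (euclAct A '' Metric.ball 0 1) ×ˢ (mulBadic hA '' Metric.closedBall 0 1) :=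
    Set.prodMap_image_prod (euclAct A) (mulBadic hA) _ _
  rw [himg, repMeasure, Measure.prod_prod, Measure.prod_prod, badicMeasure_image_unitBall,
    badicMeasure_unitBall, Measure.addHaar_image_linearMap, det_euclAct, mul_one,
    mul_right_comm] at hprod
  have h0 : (volume : Measure (EuclideanSpace ℝ (Fin n))) (Metric.ball 0 1) ≠ 0 :=
    (Metric.measure_ball_pos volume 0 one_pos).ne'
  have h1 : (volume : Measure (EuclideanSpace ℝ (Fin n))) (Metric.ball 0 1) ≠ ⊤ :=
    Metric.isBounded_ball.measure_lt_top.ne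
  rw [← (ENNReal.mul_left_inj h0 h1).1 hprod, ← ENNReal.ofReal_natCast, ← ENNReal.ofReal_natCast,
    ← ENNReal.ofReal_mul (abs_nonneg _)]
  congr 1
  have := residueCard_eq hA.isUnit_det
  exact_mod_cast this.symm

/-- The embedding `φ` restricted to `ℤⁿ[A]`. -/
def diagPoly : polyLattice A →+ RepSpace hA where
  toFun x := diag hA (inclLaurent hA x)
  map_zero' := by
    refine Prod.ext ?_ UniformSpace.Completion.coe_zero
    ext i
    exact Rat.cast_zero
  map_add' x y := by
    refine Prod.ext ?_
      (UniformSpace.Completion.coe_add (inclLaurent hA x) (inclLaurent hA y))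
    ext i
    exact Rat.cast_add _ _

theorem diagPoly_injective : Function.Injective (diagPoly hA) := by
  intro x y h
  refine Subtype.ext (funext fun i => ?_)
  have := congrArg (fun p : RepSpace hA => p.1.ofLp i) h
  exact Rat.cast_injective (α := ℝ) this

theorem mulRep_diagPoly (x : polyLattice A) :
    mulRep hA (diagPoly hA x) = diagPoly hA (mulPoly A x) := by
  refine Prod.ext ?_ (mulBadic_coe hA _)
  ext i
  change ∑ j, ((A i j : ℚ) : ℝ) * ((x.1 j : ℚ) : ℝ) = ((∑ j, A i j * x.1 j : ℚ) : ℝ)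
  push_cast
  rfl

theorem digitSum_eq_diagPoly {D : Finset (polyLattice A)} {k : ℕ} (d : Fin k → D) :
    digitSum (repEquiv hA).toAddEquiv (fun d : D => diagPoly hA d) d =
      diagPoly hA (expansion d) := by
  unfold digitSum expansion
  rw [map_sum]
  refine Finset.sum_congr rfl fun i _ => ?_
  have h : Function.Semiconj (diagPoly hA) (mulPoly A) (repEquiv hA).toAddEquiv :=
    fun x => (mulRep_diagPoly hA x).symm
  exact ((h.iterate_right i) _).symm

theorem isSelfAffineSet_iff {D : Finset (polyLattice A)} {F : Set (RepSpace hA)} :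
    IsSelfAffineSet hA D F ↔
      IsAttractor (repEquiv hA).toAddEquiv (fun d : D => diagPoly hA d) F := by
  unfold IsSelfAffineSet IsAttractor
  rw [← Finset.set_biUnion_coe, Set.biUnion_eq_iUnion]
  rfl

/-- `φ(ℤⁿ[A])` is a discrete subgroup of the representation space. -/
theorem exists_le_norm_diagPoly :
    ∃ r > 0, ∀ x : polyLattice A, x ≠ 0 → r ≤ ‖diagPoly hA x‖ := by
  obtain ⟨m, hm, h⟩ := exists_nsmul_inf_polyLattice hA.isUnit_det
  have hm' : (1 : ℝ) ≤ m := by exact_mod_cast Nat.one_le_iff_ne_zero.2 hm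
  have hm0 : (0 : ℝ) < m := by linarith
  -- As 1/m ≤ 1, the B-adic component puts `x` in ℤⁿ[A⁻¹], so m x is integral; the Euclidean
  -- component makes its coordinates smaller than 1 in absolute value, so they vanish.
  refine ⟨1 / m, by positivity, fun x hx => ?_⟩
  by_contra! hlt
  have h1 : ‖(diagPoly hA x).1‖ < 1 / m := (norm_fst_le _).trans_lt hlt
  have h2 : ‖(diagPoly hA x).2‖ < 1 / m := (norm_snd_le _).trans_lt hlt
  have hmem : x.1 ∈ polyLattice A⁻¹ := by
    have h3 : ‖(inclLaurent hA x : BadicSeries hA)‖ ≤ 1 :=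
      h2.le.trans ((div_le_one hm0).2 hm')
    have := (norm_coe_le_one_iff hA).1 h3
    rwa [filt_zero] at this
  obtain ⟨z, hz⟩ := mem_intLattice_iff.1 (h x.1 ⟨x.2, hmem⟩)
  apply hx
  refine Subtype.ext (funext fun i => ?_)
  have hzi : ((z i : ℤ) : ℝ) = m * (x.1 i : ℝ) := by
    have := congrFun hz i
    simp only [Pi.smul_apply, nsmul_eq_mul] at this
    exact_mod_cast this
  have hxi : |(x.1 i : ℝ)| < 1 / m := by
    have h4 : ‖(diagPoly hA x).1.ofLp i‖ ≤ ‖(diagPoly hA x).1‖ := PiLp.norm_apply_le _ i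
    exact h4.trans_lt h1
  have hz0 : z i = 0 := by
    rw [← Int.abs_lt_one_iff]
    have : |((z i : ℤ) : ℝ)| < 1 := by
      rw [hzi, abs_mul, abs_of_pos hm0]
      calc (m : ℝ) * |(x.1 i : ℝ)| < m * (1 / m) := by gcongr
        _ = 1 := mul_one_div_cancel hm0.ne'
    exact_mod_cast this
  rw [hz0, Int.cast_zero, eq_comm, mul_eq_zero] at hzi
  exact_mod_cast hzi.resolve_left hm0.ne'

/-- Two points in a ball of radius r/2 differ by less than r, hence coincide. No property of the
digits enters. -/
theorem isUniformlyDiscrete_image_diagPoly (s : Set (polyLattice A)) :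
    IsUniformlyDiscrete (diagPoly hA '' s) := by
  obtain ⟨r, hr, h⟩ := exists_le_norm_diagPoly hA
  refine ⟨r / 2, half_pos hr, ?_⟩
  rintro c _ ⟨hx, x, -, rfl⟩ _ ⟨hy, y, -, rfl⟩
  by_contra hne
  have h1 := h (x - y) (sub_ne_zero.2 fun e => hne (by rw [e]))
  rw [map_sub, ← dist_eq_norm] at h1
  have h2 := dist_triangle_right (diagPoly hA x) (diagPoly hA y) c
  rw [Metric.mem_ball] at hx hy
  linarith

end RepSpace

end RationalTile

end

/-! ### The characterization of positive measure -/

theorem mainTheorem2 {n : ℕ} {A : Matrix (Fin n) (Fin n) ℚ}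
    (D : Finset (RationalTile.polyLattice A)) (hD : RationalTile.IsDigitSystem A D) :
    (∃! F : Set (RationalTile.RepSpace hD.1), RationalTile.IsSelfAffineSet hD.1 D F) ∧
      ∀ F : Set (RationalTile.RepSpace hD.1), RationalTile.IsSelfAffineSet hD.1 D F →
        (0 < RationalTile.repMeasure hD.1 F ↔
          (∀ k : ℕ, 1 ≤ k →
            Function.Injective fun d : Fin k → D => RationalTile.expansion d) ∧
          RationalTile.IsUniformlyDiscrete
            ((fun x => RationalTile.diag hD.1 (RationalTile.inclLaurent hD.1 x)) ''
              RationalTile.digitBlocksInf D)) := by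
  open RationalTile in
  have hA := hD.1
  have hc := isContracting_repEquiv_symm hA
  have hcont : Continuous (repEquiv hA).toAddEquiv := (repEquiv hA).continuous
  have : Nonempty D := by
    obtain ⟨d, hd⟩ := Finset.card_pos.1 (hD.2 ▸ residueCard_pos hA.isUnit_det)
    exact ⟨d, hd⟩
  have hμ : ∀ s, repMeasure hA ((repEquiv hA).toAddEquiv '' s) =
      Fintype.card D * repMeasure hA s := fun s => by
    rw [Fintype.card_coe, hD.2]
    exact repMeasure_image hA s
  simp only [isSelfAffineSet_iff]
  refine ⟨existsUnique_isAttractor hc hcont, fun F hF => ⟨fun hpos => ⟨fun k _ => ?_,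
    isUniformlyDiscrete_image_diagPoly hA _⟩, fun ⟨hinj, r, hr, hdisc⟩ => ?_⟩⟩
  · have h := hF.digitSum_injective hμ hpos k
    simp only [digitSum_eq_diagPoly] at h
    exact h.of_comp
  · refine hF.measure_pos hc hμ (fun k hk => ?_) hr fun k hk d e hne => ?_
    · simp only [digitSum_eq_diagPoly]
      exact (diagPoly_injective hA).comp (hinj k hk)
    · have hmem : ∀ d : Fin k → D,
          digitSum (repEquiv hA).toAddEquiv (fun d : D => diagPoly hA d) d ∈
            diagPoly hA '' digitBlocksInf D := fun d =>
        ⟨expansion d, Set.mem_biUnion hk ⟨d, rfl⟩, (digitSum_eq_diagPoly hA d).symm⟩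
      -- A point common to two balls of radius r is the centre of a ball of radius r containing both
      -- digit sums.
      rw [Set.disjoint_left]
      intro c hc1 hc2
      rw [Metric.mem_ball'] at hc1 hc2
      exact hne (hdisc c ⟨hc1, hmem d⟩ ⟨hc2, hmem e⟩)
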